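/- **Theorem (de-biased graphical Lasso, regime $p\ll n$).** Let $L\ge 1$ and $K>0$. There is a constant $c_0=c_0(L,K)>0$ such that the following holds. For every $n$ let $p=p_n\ge 2$ and let $X^1,\dots,X^n$ be independent copies of a random vector $X^0\in\mathbb R^{p}$ with mean zero and covariance matrix $\Sigma_0$ (the law of $X^0$ may change with $n$), and let $\hat\Sigma=\frac1n\sum_{k=1}^n X^k(X^k)^T$. Assume, for all $n$: * (bounded spectrum) $\Theta_0=\Sigma_0^{-1}$ exists and all its eigenvalues lie in $[1/L,L]$; * (sub-Gaussianity) $\mathbb E\exp(|\alpha^TX^0|^2/K^2)\le 2$ for every $\alpha\in\mathbb R^p$ with $\|\alpha\|_2=1$. Let $d_j=\#\{i\ne j:(\Theta_0)_{ij}\ne0\}$, $d=\max_j d_j$, $s=\sum_j d_j$, and assume, as $n\to\infty$, that $$(p+s)\sqrt{d+1}=o\big(\sqrt n/\log p\big),$$ and that the non-random tuning parameter satisfies $\lambda\asymp\sqrt{\log p/n}$ with a sufficiently large constant, i.e. $\lambda=\mathcal O(\sqrt{\log p/n})$ and $\lambda\ge c_0\sqrt{\log p/n}$ for all large $n$. Let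 $\hat\Theta$ be the graphical Lasso $$\hat\Theta=\operatorname*{argmin}_{\Theta=\Theta^T,\ \Theta\succ0}\ \operatorname{tr}(\hat\Sigma\Theta)-\log\det\Theta+\lambda\sum_{i\ne j}|\Theta_{ij}|$$ whenever the minimum is attained (and an arbitrary random matrix otherwise). Then the minimum is attained with probability tending to one, and $$2\hat\Theta-\hat\Theta\hat\Sigma\hat\Theta-\Theta_0=-\Theta_0(\hat\Sigma-\Sigma_0)\Theta_0+\mathrm{rem},$$ where, with $\|A\|_\infty=\max_{i,j}|A_{ij}|$, $$\|\mathrm{rem}\|_\infty=\mathcal O_P\big(24(8L^2)^2L\,(p+s)\sqrt{d+1}\,\lambda^2\big)\quad\text{and}\quad \|\mathrm{rem}\|_\infty=o_P(1/\sqrt n).$$ Moreover, put $\sigma_{ij}^2=n\operatorname{Var}\big((\Theta_i^0)^T\hat\Sigma\,\Theta_j^0\big)$, where $\Theta_i^0$ is the $i$-th column of $\Theta_0$. For all indices $i=i_n$, $j=j_n$ in $\{1,\dots,p\}$ such that $\sigma_{ij}$ is bounded away from zero for all large $n$, $$\sqrt n\,\big(2\hat\Theta-\hat\Theta\hat\Sigma\hat\Theta-\Theta_0\big)_{ij}/\sigma_{ij}\rightsquigarrow\mathcal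 N(0,1).$$ -/

import Mathlib

open MeasureTheory ProbabilityTheory Filter Topology Asymptotics

noncomputable section

namespace DebiasedGlasso

/-- The covariance matrix of a law `μ` on `ℝᵖ`. -/
def covMat {p : ℕ} (μ : Measure (Fin p → ℝ)) : Matrix (Fin p) (Fin p) ℝ :=
  Matrix.of fun i j => cov[fun x => x i, fun x => x j; μ]

/-- The precision matrix of a law `μ` on `ℝᵖ` (meaningful when the covariance matrix is
invertible). -/
def precMat {p : ℕ} (μ : Measure (Fin p → ℝ)) : Matrix (Fin p) (Fin p) ℝ :=
  (covMat μ)⁻¹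

/-- Bounded spectrum: the precision matrix exists and all its eigenvalues lie in `[1/L, L]`. -/
def BoundedSpectrum {p : ℕ} (L : ℝ) (μ : Measure (Fin p → ℝ)) : Prop :=
  IsUnit (covMat μ) ∧ spectrum ℝ (precMat μ) ⊆ Set.Icc (1 / L) L

/-- Sub-Gaussianity with constant `K`: `E exp (|αᵀ X|² / K²) ≤ 2` for every Euclidean unit
vector `α`. -/
def SubGaussianVec {p : ℕ} (K : ℝ) (μ : Measure (Fin p → ℝ)) : Prop :=
  ∀ α : Fin p → ℝ, ∑ i, α i ^ 2 = 1 →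
    ∫⁻ x, ENNReal.ofReal (Real.exp (|α ⬝ᵥ x| ^ 2 / K ^ 2)) ∂μ ≤ 2

/-- The degree `d_j` of the node `j`: the number of nonzero off-diagonal entries in column `j`. -/
def degree {p : ℕ} (Θ : Matrix (Fin p) (Fin p) ℝ) (j : Fin p) : ℕ :=
  {i : Fin p | i ≠ j ∧ Θ i j ≠ 0}.ncard

/-- The maximum degree `d = max_j d_j`. -/
def maxDegree {p : ℕ} (Θ : Matrix (Fin p) (Fin p) ℝ) : ℕ :=
  Finset.univ.sup (degree Θ)

/-- The overall off-diagonal sparsity `s = ∑_j d_j`. -/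
def sparsity {p : ℕ} (Θ : Matrix (Fin p) (Fin p) ℝ) : ℕ :=
  ∑ j, degree Θ j

/-- The sample covariance matrix `XᵀX / n`, where the rows of `X` are the observations. -/
def sampleCov {n p : ℕ} (X : Matrix (Fin n) (Fin p) ℝ) : Matrix (Fin p) (Fin p) ℝ :=
  (1 / (n : ℝ)) • (X.transpose * X)

/-- The graphical Lasso objective `tr(S Θ) - log det Θ + lam ‖Θ⁻‖₁`, where `Θ⁻` is the
off-diagonal part of `Θ`. -/
def glassoObjective {p : ℕ} (S : Matrix (Fin p) (Fin p) ℝ) (lam : ℝ)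
    (Θ : Matrix (Fin p) (Fin p) ℝ) : ℝ :=
  (S * Θ).trace - Real.log Θ.det + lam * ∑ i, ∑ j, if i = j then 0 else |Θ i j|

/-- `Θ` is a graphical Lasso solution: it minimizes the objective over all symmetric positive
definite matrices (`Matrix.PosDef` includes symmetry). -/
def IsGraphicalLasso {p : ℕ} (S : Matrix (Fin p) (Fin p) ℝ) (lam : ℝ)
    (Θ : Matrix (Fin p) (Fin p) ℝ) : Prop :=
  Θ.PosDef ∧ ∀ Θ' : Matrix (Fin p) (Fin p) ℝ, Θ'.PosDef →
    glassoObjective S lam Θ ≤ glassoObjective S lam Θ'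

/-- The de-biased estimator `2Θ - ΘSΘ`. -/
def debiased {p : ℕ} (S Θ : Matrix (Fin p) (Fin p) ℝ) : Matrix (Fin p) (Fin p) ℝ :=
  (2 : ℝ) • Θ - Θ * S * Θ

/-- The largest absolute value of an entry. -/
def supNorm {p : ℕ} (A : Matrix (Fin p) (Fin p) ℝ) : ℝ :=
  ⨆ i, ⨆ j, |A i j|

/-- `Y n = O_P(a n)`, the `n`-th variable being defined on its own space `(Ω n, P n)`. -/
def BigOP {Ω : ℕ → Type*} [∀ n, MeasurableSpace (Ω n)] (P : ∀ n, Measure (Ω n))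
    (Y : ∀ n, Ω n → ℝ) (a : ℕ → ℝ) : Prop :=
  ∀ ε : ℝ, 0 < ε → ∃ M : ℝ, 0 < M ∧
    ∀ᶠ n in atTop, P n {ω | M * a n < |Y n ω|} ≤ ENNReal.ofReal ε

/-- `Y n = o_P(a n)`, the `n`-th variable being defined on its own space `(Ω n, P n)`. -/
def LittleOP {Ω : ℕ → Type*} [∀ n, MeasurableSpace (Ω n)] (P : ∀ n, Measure (Ω n))
    (Y : ∀ n, Ω n → ℝ) (a : ℕ → ℝ) : Prop :=
  ∀ ε : ℝ, 0 < ε → Tendsto (fun n => P n {ω | ε * a n < |Y n ω|}) atTop (𝓝 0)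

/-- `σ_{ij} = (n var((Θ_i)ᵀ Σ̂ Θ_j))^{1/2}` with `Θ_i` the columns of `Θ` and `Σ̂` the sample
covariance matrix of the random `n × p` data matrix `X`. -/
def asympStd {Ω : Type*} [MeasurableSpace Ω] {n p : ℕ} (P : Measure Ω)
    (X : Ω → Matrix (Fin n) (Fin p) ℝ) (Θ : Matrix (Fin p) (Fin p) ℝ) (i j : Fin p) : ℝ :=
  Real.sqrt ((n : ℝ) *
    Var[fun ω => (Θ.col i) ⬝ᵥ ((sampleCov (X ω)).mulVec (Θ.col j)); P])

end DebiasedGlasso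

end

namespace DebiasedGlasso

open Matrix

/-! Write `W = Σ̂ - Σ₀` and `Δ = Θ̂ - Θ₀`. Since `Σ₀Θ₀ = 1`, the terms of the de-biased estimator
that are linear in `Δ` alone cancel, and the remainder is `-ΔΣ₀Δ - ΔWΘ₀ - Θ₀WΔ - ΔWΔ`
(`remainder_eq`). So a bound `w` on the entries of `W` and a Frobenius bound on `Δ` suffice.

The Frobenius bound compares the objective at `Θ̂` and at `Θ₀`. The excess at `Θ̂`, with `Σ₀` in
place of `Σ̂`, is the Bregman divergence of `-log det`. It is at least `x² / (2(1 + x))` with `x =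
‖Δ‖_F / L` (`bregman_ge`), and at most a multiple of `λ √(p + s) ‖Δ‖_F`, because the penalty absorbs
the noise off the support of `Θ₀`. As `λ √(p + s)` is small, this forces `‖Δ‖_F = O(λ √(p + s))`.
The columns of `Θ₀` have at most `d + 1` nonzero entries, which produces the factor `√(d + 1)` in
the cross terms. This argument applies to every minimizer, so uniqueness plays no role; a minimizer
exists as soon as `Σ̂` is positive definite, which holds when `p w` is small.

The entries of `W` are controlled by a Bernstein inequality and a union bound over the `p²` entries.
The event `w ≤ λ` fails with probability at most `2 / p`, which is not small when `p` stays bounded.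
For such `p` the noise level is enlarged by a factor `M`, and a dimension-dependent bound replaces
the sparsity argument at the cost of a constant only (`exists_measure_deviation_le`).

The linear term is a normalized sum of independent sub-exponential variables whose third moments are
uniformly bounded. Its characteristic function converges to that of `N(0, 1)`, and the remainder,
being `o_P(1/√n)`, does not affect the limit. -/

/-! ### Orthogonal diagonalization and quadratic forms -/

theorem exists_orthogonal_diagonalization {p : ℕ} {A : Matrix (Fin p) (Fin p) ℝ}
    (hA : A.IsHermitian) {s : Set ℝ} (hs : spectrum ℝ A ⊆ s) :
    ∃ (U : Matrix (Fin p) (Fin p) ℝ) (d : Fin p → ℝ),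
      Uᵀ * U = 1 ∧ U * Uᵀ = 1 ∧ A = U * diagonal d * Uᵀ ∧ ∀ i, d i ∈ s := by
  refine ⟨hA.eigenvectorUnitary, hA.eigenvalues, ?_, ?_, ?_, fun i => hs (hA.eigenvalues_mem_spectrum_real i)⟩
  · exact Unitary.coe_star_mul_self hA.eigenvectorUnitary
  · exact Unitary.coe_mul_star_self hA.eigenvectorUnitary
  · have := hA.spectral_theorem
    rw [Unitary.conjStarAlgAut_apply] at this
    exact this

theorem dotProduct_mulVec_orthogonal {p : ℕ} {U : Matrix (Fin p) (Fin p) ℝ}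
    (hU : Uᵀ * U = 1) (v w : Fin p → ℝ) : (U *ᵥ v) ⬝ᵥ (U *ᵥ w) = v ⬝ᵥ w := by
  rw [Matrix.dotProduct_mulVec, Matrix.vecMul_mulVec, ← Matrix.mulVec_transpose]
  simp [hU]

theorem mulVec_dotProduct_self_le {p : ℕ} {U : Matrix (Fin p) (Fin p) ℝ} {d : Fin p → ℝ} {L : ℝ}
    (hU : Uᵀ * U = 1) (hU' : U * Uᵀ = 1) (hd : ∀ i, |d i| ≤ L) (v : Fin p → ℝ) :
    ((U * diagonal d * Uᵀ) *ᵥ v) ⬝ᵥ ((U * diagonal d * Uᵀ) *ᵥ v) ≤ L ^ 2 * (v ⬝ᵥ v) := by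
  rw [← Matrix.mulVec_mulVec, ← Matrix.mulVec_mulVec, dotProduct_mulVec_orthogonal hU,
    ← dotProduct_mulVec_orthogonal (U := Uᵀ) (by simpa using hU') v v]
  simp only [dotProduct, Finset.mul_sum, Matrix.mulVec_diagonal]
  refine Finset.sum_le_sum fun i _ => ?_
  have h : d i ^ 2 ≤ L ^ 2 := sq_le_sq' (by linarith [neg_abs_le (d i), hd i]) ((le_abs_self _).trans (hd i))
  nlinarith [mul_le_mul_of_nonneg_right h (sq_nonneg ((Uᵀ *ᵥ v) i))]

theorem le_dotProduct_mulVec {p : ℕ} {U : Matrix (Fin p) (Fin p) ℝ} {d : Fin p → ℝ} {a : ℝ}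
    (hU' : U * Uᵀ = 1) (hd : ∀ i, a ≤ d i) (v : Fin p → ℝ) :
    a * (v ⬝ᵥ v) ≤ v ⬝ᵥ ((U * diagonal d * Uᵀ) *ᵥ v) := by
  rw [← Matrix.mulVec_mulVec, ← Matrix.mulVec_mulVec, Matrix.dotProduct_mulVec v U,
    ← Matrix.mulVec_transpose U v,
    ← dotProduct_mulVec_orthogonal (U := Uᵀ) (by simpa using hU') v v]
  simp only [dotProduct, Finset.mul_sum, Matrix.mulVec_diagonal]
  refine Finset.sum_le_sum fun i _ => ?_
  nlinarith [mul_le_mul_of_nonneg_right (hd i) (sq_nonneg ((Uᵀ *ᵥ v) i))]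

/-! ### Frobenius norm and the Bregman divergence of `-log det` -/

/-- The squared Frobenius norm. -/
noncomputable def frobSq {p : ℕ} (A : Matrix (Fin p) (Fin p) ℝ) : ℝ := ∑ i, ∑ j, A i j ^ 2

theorem frobSq_nonneg {p : ℕ} (A : Matrix (Fin p) (Fin p) ℝ) : 0 ≤ frobSq A :=
  Finset.sum_nonneg fun _ _ => Finset.sum_nonneg fun _ _ => sq_nonneg _

theorem frobSq_eq_trace {p : ℕ} (A : Matrix (Fin p) (Fin p) ℝ) :
    frobSq A = (A * Aᵀ).trace := by
  simp [frobSq, Matrix.trace, Matrix.mul_apply, pow_two]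

theorem frobSq_conj {p : ℕ} {U : Matrix (Fin p) (Fin p) ℝ} (hU : U * Uᵀ = 1)
    (A : Matrix (Fin p) (Fin p) ℝ) : frobSq (Uᵀ * A * U) = frobSq A := by
  rw [frobSq_eq_trace, frobSq_eq_trace]
  have h : Uᵀ * A * U * (Uᵀ * A * U)ᵀ = Uᵀ * (A * Aᵀ) * U := by
    simp only [Matrix.transpose_mul, Matrix.transpose_transpose]
    calc Uᵀ * A * U * (Uᵀ * (Aᵀ * U)) = Uᵀ * A * (U * Uᵀ) * (Aᵀ * U) := by
          simp only [Matrix.mul_assoc]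
      _ = _ := by rw [hU]; simp only [Matrix.mul_assoc, Matrix.one_mul]
  rw [h, Matrix.trace_mul_cycle, hU, Matrix.one_mul]

/-- For `x ≥ 1`, `log x ≤ sinh (log x) = (x - 1/x) / 2` leaves `(x - 1)² / (2x)`, and `x ≤ 1 + N`.
For `x < 1`, the first two terms of the series of `-log (1 - y)` at `y = 1 - x` already give `(x -
1)² / 2`. -/
theorem sq_div_le_sub_log {x N : ℝ} (hx : 0 < x) (hN : |x - 1| ≤ N) :
    (x - 1) ^ 2 / (2 * (1 + N)) ≤ x - 1 - Real.log x := by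
  have hN0 : 0 ≤ N := (abs_nonneg _).trans hN
  rcases le_or_gt 1 x with h | h
  · have hs : Real.log x ≤ (x - x⁻¹) / 2 := by
      rw [← Real.sinh_log hx]
      exact Real.self_le_sinh_iff.2 (Real.log_nonneg h)
    have h1 : x ≤ 1 + N := by linarith [le_abs_self (x - 1)]
    have h2 : (x - 1) ^ 2 / (2 * (1 + N)) ≤ (x - 1) ^ 2 / (2 * x) := by gcongr
    have h3 : (x - 1) ^ 2 / (2 * x) = x - 1 - (x - x⁻¹) / 2 := by field_simp; ring
    linarith
  · have h1 := Real.hasSum_pow_div_log_of_abs_lt_one (x := 1 - x) (by rw [abs_lt]; constructor <;> linarith)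
    have h2 := sum_le_hasSum (Finset.range 2) (fun i _ => by
      have : 0 ≤ 1 - x := by linarith
      positivity) h1
    simp [Finset.sum_range_succ] at h2
    have h3 : (x - 1) ^ 2 / (2 * (1 + N)) ≤ (x - 1) ^ 2 / 2 := by
      gcongr; linarith
    nlinarith

/-- Lower bound for the Bregman divergence of `-log det` at the identity. -/
theorem trace_sub_log_det_ge {p : ℕ} {M : Matrix (Fin p) (Fin p) ℝ} (hM : M.PosDef) :
    frobSq (M - 1) / (2 * (1 + √(frobSq (M - 1)))) ≤ (M - 1).trace - Real.log M.det := by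
  obtain ⟨U, d, hU, hU', hMd, hd⟩ :=
    exists_orthogonal_diagonalization hM.1 (s := Set.Ioi 0) (by
      intro x hx
      rw [hM.1.spectrum_real_eq_range_eigenvalues] at hx
      obtain ⟨i, rfl⟩ := hx
      exact hM.eigenvalues_pos i)
  have h1 : Uᵀ * (M - 1) * U = diagonal (fun i => d i - 1) := by
    rw [Matrix.mul_sub, Matrix.sub_mul, Matrix.mul_one, hU, hMd]
    have : Uᵀ * (U * diagonal d * Uᵀ) * U = (Uᵀ * U) * diagonal d * (Uᵀ * U) := by
      simp only [Matrix.mul_assoc]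
    rw [this, hU, Matrix.one_mul, Matrix.mul_one]
    ext i j
    by_cases h : i = j <;> simp [h]
  -- In the eigenbasis all quantities become sums over eigenvalues. Each `|d i - 1|` is at most the
  -- Frobenius norm of `M - 1`, so the scalar inequality applies with one common `N`.
  have h2 : frobSq (M - 1) = ∑ i, (d i - 1) ^ 2 := by
    rw [← frobSq_conj hU', h1]
    simp [frobSq, Matrix.diagonal_apply, ite_pow]
  have h3 : (M - 1).trace = ∑ i, (d i - 1) := by
    rw [← Matrix.trace_diagonal, ← h1, Matrix.trace_mul_cycle, hU', Matrix.one_mul]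
  have h4 : M.det = ∏ i, d i := by
    have hh : U.det * Uᵀ.det = 1 := by rw [← Matrix.det_mul, hU', Matrix.det_one]
    rw [hMd, Matrix.det_mul, Matrix.det_mul, Matrix.det_diagonal]
    linear_combination (∏ i, d i) * hh
  rw [h3, h4, Real.log_prod (fun i _ => (hd i).ne'), ← Finset.sum_sub_distrib]
  conv_lhs => rw [h2]
  rw [Finset.sum_div]
  refine Finset.sum_le_sum fun i _ => sq_div_le_sub_log (hd i) ?_
  refine Real.abs_le_sqrt ?_
  exact Finset.single_le_sum (f := fun i => (d i - 1) ^ 2) (fun _ _ => sq_nonneg _) (Finset.mem_univ i)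

theorem sq_div_mono {x y : ℝ} (hx : 0 ≤ x) (hxy : x ≤ y) :
    x ^ 2 / (2 * (1 + x)) ≤ y ^ 2 / (2 * (1 + y)) := by
  have hy := hx.trans hxy
  rw [div_le_div_iff₀ (by positivity) (by positivity)]
  nlinarith [mul_nonneg hx hy, mul_nonneg (mul_nonneg hx hy) (sub_nonneg.2 hxy), mul_nonneg (sub_nonneg.2 hxy) (add_nonneg hx hy)]

/-- Lower bound for the Bregman divergence of `-log det`. -/
theorem bregman_ge {p : ℕ} {U Θ Θ₀ S₀ : Matrix (Fin p) (Fin p) ℝ} {d : Fin p → ℝ} {L : ℝ}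
    (hL : 0 < L)
    (hU : Uᵀ * U = 1) (hU' : U * Uᵀ = 1) (hd : ∀ i, 0 < d i) (hdL : ∀ i, d i ≤ L)
    (hΘ₀ : Θ₀ = U * diagonal d * Uᵀ) (hS₀ : S₀ = U * diagonal (fun i => (d i)⁻¹) * Uᵀ)
    (hΘ : Θ.PosDef) :
    (√(frobSq (Θ - Θ₀)) / L) ^ 2 / (2 * (1 + √(frobSq (Θ - Θ₀)) / L)) ≤
      (S₀ * (Θ - Θ₀)).trace - Real.log Θ.det + Real.log Θ₀.det := by
  -- Congruence by `B = U diag(d^{-1/2})` sends `Θ₀` to `1` and preserves the divergence, which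
  -- reduces the claim to the identity matrix. Since `d i ≤ L`, it shrinks Frobenius distances by a
  -- factor of at most `L`.
  set e : Fin p → ℝ := fun i => (√(d i))⁻¹ with he
  have hs : ∀ i, 0 < √(d i) := fun i => Real.sqrt_pos.2 (hd i)
  have hee : ∀ i, e i * e i = (d i)⁻¹ := fun i => by
    simp only [he]; rw [← mul_inv, Real.mul_self_sqrt (hd i).le]
  set B := U * diagonal e with hB
  have hBT : Bᵀ = diagonal e * Uᵀ := by simp [hB, Matrix.transpose_mul]
  have hBdet : B.det ≠ 0 := by
    have hh : U.det * Uᵀ.det = 1 := by rw [← Matrix.det_mul, hU', Matrix.det_one]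
    rw [hB, Matrix.det_mul, Matrix.det_diagonal]
    exact mul_ne_zero (left_ne_zero_of_mul_eq_one hh) (Finset.prod_ne_zero_iff.2 fun i _ => (inv_pos.2 (hs i)).ne')
  have hBB : B * Bᵀ = S₀ := by
    rw [hBT, hB, hS₀]
    calc U * diagonal e * (diagonal e * Uᵀ) = U * (diagonal e * diagonal e) * Uᵀ := by
          simp only [Matrix.mul_assoc]
      _ = _ := by rw [Matrix.diagonal_mul_diagonal]; simp only [hee]
  have hBΘ : Bᵀ * Θ₀ * B = 1 := by
    rw [hBT, hB, hΘ₀]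
    calc diagonal e * Uᵀ * (U * diagonal d * Uᵀ) * (U * diagonal e)
        = diagonal e * (Uᵀ * U) * diagonal d * (Uᵀ * U) * diagonal e := by
          simp only [Matrix.mul_assoc]
      _ = diagonal e * diagonal d * diagonal e := by rw [hU]; simp
      _ = 1 := by
        rw [Matrix.diagonal_mul_diagonal, Matrix.diagonal_mul_diagonal, ← Matrix.diagonal_one]
        congr 1; ext i
        have := hee i
        have h0 := (hd i).ne'
        calc e i * d i * e i = (e i * e i) * d i := by ring
          _ = 1 := by rw [this, inv_mul_cancel₀ h0]
  set M := Bᵀ * Θ * B with hMdef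
  have hM : M.PosDef := by
    have := hΘ.conjTranspose_mul_mul_same (B := B)
      (Matrix.mulVec_injective_of_isUnit ((Matrix.isUnit_iff_isUnit_det _).2 hBdet.isUnit))
    simpa [hMdef, Matrix.conjTranspose_eq_transpose_of_trivial] using this
  have hM1 : M - 1 = Bᵀ * (Θ - Θ₀) * B := by
    rw [Matrix.mul_sub, Matrix.sub_mul, hBΘ]
  have htr : (M - 1).trace = (S₀ * (Θ - Θ₀)).trace := by
    rw [hM1, Matrix.trace_mul_cycle, hBB]
  have hΘ₀det : B.det * B.det * Θ₀.det = 1 := by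
    have := congrArg Matrix.det hBΘ
    rw [Matrix.det_mul, Matrix.det_mul, Matrix.det_transpose, Matrix.det_one] at this
    linear_combination this
  have hdet : Real.log M.det = Real.log Θ.det - Real.log Θ₀.det := by
    have h0 : Θ₀.det ≠ 0 := right_ne_zero_of_mul_eq_one hΘ₀det
    rw [← Real.log_div hΘ.det_pos.ne' h0]
    congr 1
    rw [hMdef, Matrix.det_mul, Matrix.det_mul, Matrix.det_transpose, eq_div_iff h0]
    linear_combination Θ.det * hΘ₀det
  have hfrob : frobSq (Θ - Θ₀) ≤ L ^ 2 * frobSq (M - 1) := by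
    have h1 : M - 1 = diagonal e * (Uᵀ * (Θ - Θ₀) * U) * diagonal e := by
      rw [hM1, hBT, hB]; simp only [Matrix.mul_assoc]
    rw [← frobSq_conj hU' (Θ - Θ₀), h1]
    simp only [frobSq, Finset.mul_sum, Matrix.mul_diagonal, Matrix.diagonal_mul]
    refine Finset.sum_le_sum fun i _ => Finset.sum_le_sum fun j _ => ?_
    set z := (Uᵀ * (Θ - Θ₀) * U) i j
    have h2 : (e i * z * e j) ^ 2 = (d i)⁻¹ * (d j)⁻¹ * z ^ 2 := by
      rw [← hee, ← hee]; ring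
    rw [h2]
    have h3 : 1 ≤ L ^ 2 * ((d i)⁻¹ * (d j)⁻¹) := by
      rw [← mul_inv, ← div_eq_mul_inv, le_div_iff₀ (mul_pos (hd i) (hd j)), one_mul, pow_two]
      exact mul_le_mul (hdL i) (hdL j) (hd j).le hL.le
    nlinarith [mul_le_mul_of_nonneg_right h3 (sq_nonneg z)]
  have hx : √(frobSq (Θ - Θ₀)) / L ≤ √(frobSq (M - 1)) := by
    rw [div_le_iff₀ hL]
    calc √(frobSq (Θ - Θ₀)) ≤ √(L ^ 2 * frobSq (M - 1)) := Real.sqrt_le_sqrt hfrob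
      _ = _ := by rw [Real.sqrt_mul (sq_nonneg L), Real.sqrt_sq hL.le, mul_comm]
  have hmain := trace_sub_log_det_ge hM
  refine (sq_div_mono (by positivity) hx).trans ?_
  rw [Real.sq_sqrt (frobSq_nonneg _)]
  rw [htr, hdet] at hmain
  linarith

/-! ### Entrywise bounds and sparsity counts -/

theorem mul_mul_apply_eq_dotProduct {p : ℕ} (A B C : Matrix (Fin p) (Fin p) ℝ) (i j : Fin p) :
    (A * B * C) i j = A i ⬝ᵥ (B *ᵥ fun k => C k j) := by
  rw [Matrix.mul_assoc]
  rfl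

theorem abs_dotProduct_le {p : ℕ} (u v : Fin p → ℝ) :
    |u ⬝ᵥ v| ≤ √(u ⬝ᵥ u) * √(v ⬝ᵥ v) := by
  rw [← Real.sqrt_mul (by simpa [dotProduct] using Finset.sum_nonneg fun i _ => mul_self_nonneg (u i))]
  refine Real.abs_le_sqrt ?_
  simpa [dotProduct, pow_two] using Finset.sum_mul_sq_le_sq_mul_sq Finset.univ u v

theorem sum_abs_le_sqrt_card {ι : Type*} (s : Finset ι) (u : ι → ℝ) :
    ∑ i ∈ s, |u i| ≤ √(s.card : ℝ) * √(∑ i ∈ s, u i ^ 2) := by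
  rw [← Real.sqrt_mul (by positivity)]
  refine Real.le_sqrt_of_sq_le ?_
  simpa using sq_sum_le_card_mul_sum_sq (s := s) (f := fun i => |u i|)

theorem abs_dotProduct_mulVec_le {p : ℕ} {W : Matrix (Fin p) (Fin p) ℝ} {w : ℝ}
    (hW : ∀ a b, |W a b| ≤ w) (u v : Fin p → ℝ) :
    |u ⬝ᵥ (W *ᵥ v)| ≤ w * (∑ i, |u i|) * ∑ j, |v j| := by
  calc |u ⬝ᵥ (W *ᵥ v)| = |∑ i, ∑ j, u i * (W i j * v j)| := by
        simp [dotProduct, Matrix.mulVec, Finset.mul_sum]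
    _ ≤ ∑ i, ∑ j, |u i| * (w * |v j|) := by
        refine (Finset.abs_sum_le_sum_abs _ _).trans (Finset.sum_le_sum fun i _ => ?_)
        refine (Finset.abs_sum_le_sum_abs _ _).trans (Finset.sum_le_sum fun j _ => ?_)
        rw [abs_mul, abs_mul]
        have := hW i j
        gcongr
    _ = _ := by
        rw [mul_assoc, Finset.sum_mul_sum, Finset.mul_sum]
        refine Finset.sum_congr rfl fun i _ => ?_
        rw [Finset.mul_sum]
        exact Finset.sum_congr rfl fun j _ => by ring

theorem sum_abs_le_sqrt_mul {p : ℕ} (u : Fin p → ℝ) :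
    ∑ i, |u i| ≤ √(p : ℝ) * √(u ⬝ᵥ u) := by
  simpa [dotProduct, pow_two] using sum_abs_le_sqrt_card Finset.univ u

theorem row_sq_le_frobSq {p : ℕ} (A : Matrix (Fin p) (Fin p) ℝ) (i : Fin p) :
    A i ⬝ᵥ A i ≤ frobSq A := by
  have := Finset.single_le_sum (f := fun i => ∑ j, A i j ^ 2)
    (fun _ _ => Finset.sum_nonneg fun _ _ => sq_nonneg _) (Finset.mem_univ i)
  simpa [frobSq, dotProduct, pow_two] using this

theorem col_sq_le_frobSq {p : ℕ} (A : Matrix (Fin p) (Fin p) ℝ) (j : Fin p) :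
    (fun k => A k j) ⬝ᵥ (fun k => A k j) ≤ frobSq A := by
  have h : frobSq A = ∑ j, ∑ i, A i j ^ 2 := Finset.sum_comm
  have := Finset.single_le_sum (f := fun j => ∑ i, A i j ^ 2)
    (fun _ _ => Finset.sum_nonneg fun _ _ => sq_nonneg _) (Finset.mem_univ j)
  rw [h]
  simpa [dotProduct, pow_two] using this

theorem card_filter_col {p : ℕ} (Θ : Matrix (Fin p) (Fin p) ℝ) (j : Fin p) :
    (Finset.univ.filter fun i => i = j ∨ Θ i j ≠ 0).card = degree Θ j + 1 := by
  classical
  have h : (Finset.univ.filter fun i => i = j ∨ Θ i j ≠ 0)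
      = insert j (Finset.univ.filter fun i => i ≠ j ∧ Θ i j ≠ 0) := by
    ext i; by_cases h : i = j <;> simp [h]
  rw [h, Finset.card_insert_of_notMem (by simp), degree, ← Set.ncard_coe_finset]
  simp

/-- The diagonal belongs to the support set because it is not penalized; this is why the rate
involves `p + s` and not `s`. -/
theorem card_filter_support {p : ℕ} (Θ : Matrix (Fin p) (Fin p) ℝ) :
    (Finset.univ.filter fun x : Fin p × Fin p => x.1 = x.2 ∨ Θ x.1 x.2 ≠ 0).card
      = p + sparsity Θ := by
  rw [Finset.card_filter, Fintype.sum_prod_type_right]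
  simp_rw [← Finset.card_filter, card_filter_col]
  simp [Finset.sum_add_distrib, sparsity, add_comm]

theorem sum_abs_col_le {p : ℕ} (Θ : Matrix (Fin p) (Fin p) ℝ) (j : Fin p) :
    ∑ i, |Θ i j| ≤ √((maxDegree Θ : ℝ) + 1) * √((fun k => Θ k j) ⬝ᵥ (fun k => Θ k j)) := by
  have h1 : ∑ i, |Θ i j| = ∑ i ∈ Finset.univ.filter (fun i => i = j ∨ Θ i j ≠ 0), |Θ i j| := by
    refine (Finset.sum_filter_of_ne fun i _ h => Or.inr ?_).symm
    simpa using h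
  rw [h1]
  refine (sum_abs_le_sqrt_card _ fun i => Θ i j).trans ?_
  rw [card_filter_col]
  have h2 : degree Θ j ≤ maxDegree Θ := Finset.le_sup (f := degree Θ) (Finset.mem_univ j)
  have h3 : ((degree Θ j + 1 : ℕ) : ℝ) ≤ (maxDegree Θ : ℝ) + 1 := by exact_mod_cast Nat.succ_le_succ h2
  gcongr
  simp only [dotProduct, ← pow_two]
  exact Finset.sum_le_sum_of_subset_of_nonneg (Finset.filter_subset _ _) fun _ _ _ => sq_nonneg _

/-! ### Basic inequality and Frobenius rate of the graphical Lasso -/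

theorem abs_trace_mul_le {p : ℕ} {W : Matrix (Fin p) (Fin p) ℝ} {w : ℝ}
    (hW : ∀ a b, |W a b| ≤ w) (Δ : Matrix (Fin p) (Fin p) ℝ) :
    |(W * Δ).trace| ≤ ∑ x : Fin p × Fin p, w * |Δ x.1 x.2| := by
  rw [Fintype.sum_prod_type_right]
  simp only [Matrix.trace, Matrix.diag_apply, Matrix.mul_apply]
  refine (Finset.abs_sum_le_sum_abs _ _).trans (Finset.sum_le_sum fun i _ => ?_)
  refine (Finset.abs_sum_le_sum_abs _ _).trans (Finset.sum_le_sum fun j _ => ?_)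
  rw [abs_mul]
  exact mul_le_mul_of_nonneg_right (hW i j) (abs_nonneg _)

/-- Optimality of `Θ` against the competitor `Θ₀`, with `S` replaced by `S₀` at the price of `|tr((S
- S₀)(Θ - Θ₀))|`. -/
theorem glasso_basic_inequality {p : ℕ} {S S₀ Θ Θ₀ : Matrix (Fin p) (Fin p) ℝ} {lam w : ℝ}
    (hΘ₀ : Θ₀.PosDef) (hΘ : IsGraphicalLasso S lam Θ) (hW : ∀ a b, |(S - S₀) a b| ≤ w) :
    (S₀ * (Θ - Θ₀)).trace - Real.log Θ.det + Real.log Θ₀.det ≤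
      ∑ x : Fin p × Fin p, (w * |(Θ - Θ₀) x.1 x.2|
        + if x.1 = x.2 then 0 else lam * (|Θ₀ x.1 x.2| - |Θ x.1 x.2|)) := by
  have h1 := hΘ.2 Θ₀ hΘ₀
  have h2 := abs_trace_mul_le hW (Θ - Θ₀)
  have h3 : ((S - S₀) * (Θ - Θ₀)).trace = (S * Θ).trace - (S * Θ₀).trace - (S₀ * (Θ - Θ₀)).trace := by
    simp only [Matrix.sub_mul, Matrix.mul_sub, Matrix.trace_sub]
    ring
  have h4 : ∑ x : Fin p × Fin p, (if x.1 = x.2 then 0 else lam * (|Θ₀ x.1 x.2| - |Θ x.1 x.2|))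
      = lam * (∑ i, ∑ j, if i = j then 0 else |Θ₀ i j|)
        - lam * (∑ i, ∑ j, if i = j then 0 else |Θ i j|) := by
    rw [Fintype.sum_prod_type, ← mul_sub, ← Finset.sum_sub_distrib, Finset.mul_sum]
    refine Finset.sum_congr rfl fun i _ => ?_
    rw [← Finset.sum_sub_distrib, Finset.mul_sum]
    refine Finset.sum_congr rfl fun j _ => ?_
    split_ifs <;> simp
  rw [Finset.sum_add_distrib, h4]
  unfold glassoObjective at h1
  linarith [neg_abs_le ((S - S₀) * (Θ - Θ₀)).trace]

theorem sum_abs_support_le {p : ℕ} (Θ₀ Δ : Matrix (Fin p) (Fin p) ℝ) :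
    ∑ x ∈ Finset.univ.filter (fun x : Fin p × Fin p => x.1 = x.2 ∨ Θ₀ x.1 x.2 ≠ 0), |Δ x.1 x.2| ≤
      √((p + sparsity Θ₀ : ℕ) : ℝ) * √(frobSq Δ) := by
  refine (sum_abs_le_sqrt_card _ fun x : Fin p × Fin p => Δ x.1 x.2).trans ?_
  rw [card_filter_support]
  gcongr
  rw [frobSq, ← Fintype.sum_prod_type' (f := fun i j => Δ i j ^ 2)]
  exact Finset.sum_le_sum_of_subset_of_nonneg (Finset.filter_subset _ _) fun _ _ _ => sq_nonneg _

/-- The penalized error is controlled by the Frobenius norm, when the penalty dominates the noise. -/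
theorem penalized_error_le {p : ℕ} {Θ Θ₀ : Matrix (Fin p) (Fin p) ℝ} {lam w : ℝ}
    (hw : w ≤ lam) (hlam : 0 ≤ lam) :
    ∑ x : Fin p × Fin p, (w * |(Θ - Θ₀) x.1 x.2|
        + if x.1 = x.2 then 0 else lam * (|Θ₀ x.1 x.2| - |Θ x.1 x.2|)) ≤
      2 * lam * √((p + sparsity Θ₀ : ℕ) : ℝ) * √(frobSq (Θ - Θ₀)) := by
  have h := sum_abs_support_le Θ₀ (Θ - Θ₀)
  have h1 := mul_le_mul_of_nonneg_left h (mul_nonneg zero_le_two hlam)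
  rw [Finset.mul_sum, Finset.sum_filter] at h1
  refine le_trans (Finset.sum_le_sum fun x _ => ?_) (h1.trans_eq (by ring))
  have h2 : |Θ₀ x.1 x.2| - |Θ x.1 x.2| ≤ |(Θ - Θ₀) x.1 x.2| := by
    rw [Matrix.sub_apply, abs_sub_comm]; exact abs_sub_abs_le_abs_sub _ _
  have h3 := abs_nonneg ((Θ - Θ₀) x.1 x.2)
  have h4 := mul_le_mul_of_nonneg_left h2 hlam
  have h5 := mul_le_mul_of_nonneg_right hw h3
  have h6 := mul_nonneg hlam h3
  -- On the diagonal only the noise counts, and it is at most `lam * |Δ|`. Where `Θ₀` vanishes, `Δ =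
  -- Θ` and the penalty `lam * |Θ|` outweighs the noise. On the rest of the support noise and
  -- penalty give `lam * |Δ|` each, whence the factor 2.
  by_cases h7 : x.1 = x.2
  · simp only [h7, if_true, true_or] at *
    linarith
  · by_cases h8 : Θ₀ x.1 x.2 = 0
    · simp only [h7, h8, if_false, ne_eq, not_true_eq_false, or_self, Matrix.sub_apply, sub_zero, abs_zero, zero_sub] at *
      linarith
    · simp only [h7, h8, if_false, ne_eq, not_false_eq_true, or_true, if_true]
      linarith

/-- The penalized error is controlled by the Frobenius norm, with a dimension-dependent constant. -/
theorem penalized_error_le_crude {p : ℕ} {Θ Θ₀ : Matrix (Fin p) (Fin p) ℝ} {lam w : ℝ}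
    (hw : 0 ≤ w) (hlam : 0 ≤ lam) :
    ∑ x : Fin p × Fin p, (w * |(Θ - Θ₀) x.1 x.2|
        + if x.1 = x.2 then 0 else lam * (|Θ₀ x.1 x.2| - |Θ x.1 x.2|)) ≤
      (w + lam) * p * √(frobSq (Θ - Θ₀)) := by
  have h := sum_abs_le_sqrt_card Finset.univ fun x : Fin p × Fin p => (Θ - Θ₀) x.1 x.2
  have hc : √((Finset.univ : Finset (Fin p × Fin p)).card : ℝ) = p := by
    rw [Finset.card_univ, Fintype.card_prod, Fintype.card_fin]
    push_cast
    exact Real.sqrt_mul_self (Nat.cast_nonneg p)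
  rw [hc, Fintype.sum_prod_type' (f := fun i j => (Θ - Θ₀) i j ^ 2)] at h
  have h1 := mul_le_mul_of_nonneg_left h (add_nonneg hw hlam)
  rw [Finset.mul_sum] at h1
  refine le_trans (Finset.sum_le_sum fun x _ => ?_) (h1.trans_eq (by rw [frobSq]; ring))
  have h2 : |Θ₀ x.1 x.2| - |Θ x.1 x.2| ≤ |(Θ - Θ₀) x.1 x.2| := by
    rw [Matrix.sub_apply, abs_sub_comm]; exact abs_sub_abs_le_abs_sub _ _
  have h4 := mul_le_mul_of_nonneg_left h2 hlam
  have h6 := mul_nonneg hlam (abs_nonneg ((Θ - Θ₀) x.1 x.2))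
  split_ifs <;> linarith

/-- Solving the quadratic inequality of the rate of convergence. -/
theorem le_of_sq_div_le {x δ : ℝ} (hx : 0 ≤ x) (hδ0 : 0 ≤ δ) (hδ : δ ≤ 1 / 4)
    (h : x ^ 2 / (2 * (1 + x)) ≤ δ * x) : x ≤ 4 * δ := by
  rw [div_le_iff₀ (by positivity)] at h
  rcases hx.eq_or_lt with rfl | hx
  · linarith
  · have : x ≤ δ * (2 * (1 + x)) := by
      refine le_of_mul_le_mul_right ?_ hx
      linarith
    nlinarith

/-! ### Algebra and size of the remainder -/

/-- The remainder of the linear expansion of the de-biased estimator. -/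
def remainder {p : ℕ} (S S₀ Θ Θ₀ : Matrix (Fin p) (Fin p) ℝ) : Matrix (Fin p) (Fin p) ℝ :=
  debiased S Θ - Θ₀ + Θ₀ * (S - S₀) * Θ₀

theorem remainder_eq {p : ℕ} {S S₀ Θ Θ₀ : Matrix (Fin p) (Fin p) ℝ}
    (h1 : S₀ * Θ₀ = 1) (h2 : Θ₀ * S₀ = 1) :
    remainder S S₀ Θ Θ₀ = -((Θ - Θ₀) * S₀ * (Θ - Θ₀)) - (Θ - Θ₀) * (S - S₀) * Θ₀
      - Θ₀ * (S - S₀) * (Θ - Θ₀) - (Θ - Θ₀) * (S - S₀) * (Θ - Θ₀) := by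
  unfold remainder debiased
  have h3 : Θ₀ * S₀ * Θ₀ = Θ₀ := by rw [h2, Matrix.one_mul]
  have h4 : Θ * S₀ * Θ₀ = Θ := by rw [Matrix.mul_assoc, h1, Matrix.mul_one]
  have h5 : Θ₀ * S₀ * Θ = Θ := by rw [h2, Matrix.one_mul]
  simp only [Matrix.mul_sub, Matrix.sub_mul, h3, h4, h5, two_smul]
  abel

/-- The term quadratic in `Δ` with `S₀` is bounded by Cauchy–Schwarz. The terms with `S - S₀` use
the `ℓ₁`–`ℓ∞` duality: rows and columns of `Δ` have `ℓ₁` norm at most `√p ρ`, while those of `Θ₀`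
have at most `√(d + 1) L` by sparsity. -/
theorem abs_remainder_le {p : ℕ} {S S₀ Θ Θ₀ : Matrix (Fin p) (Fin p) ℝ} {L w ρ : ℝ}
    (hL : 0 ≤ L) (hw : 0 ≤ w) (hρ : 0 ≤ ρ) (hsymm : Θ₀ᵀ = Θ₀)
    (h1 : S₀ * Θ₀ = 1) (h2 : Θ₀ * S₀ = 1)
    (hS₀ : ∀ v : Fin p → ℝ, (S₀ *ᵥ v) ⬝ᵥ (S₀ *ᵥ v) ≤ L ^ 2 * (v ⬝ᵥ v))
    (hΘ₀ : ∀ v : Fin p → ℝ, (Θ₀ *ᵥ v) ⬝ᵥ (Θ₀ *ᵥ v) ≤ L ^ 2 * (v ⬝ᵥ v))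
    (hW : ∀ a b, |(S - S₀) a b| ≤ w) (hΔ : √(frobSq (Θ - Θ₀)) ≤ ρ) (i j : Fin p) :
    |remainder S S₀ Θ Θ₀ i j| ≤
      L * ρ ^ 2 + 2 * (w * (√((maxDegree Θ₀ : ℝ) + 1) * L) * (√(p : ℝ) * ρ)) + w * p * ρ ^ 2 := by
  set Δ := Θ - Θ₀ with hΔdef
  have hrow : √(Δ i ⬝ᵥ Δ i) ≤ ρ := (Real.sqrt_le_sqrt (row_sq_le_frobSq Δ i)).trans hΔ
  have hcol : √((fun k => Δ k j) ⬝ᵥ (fun k => Δ k j)) ≤ ρ :=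
    (Real.sqrt_le_sqrt (col_sq_le_frobSq Δ j)).trans hΔ
  have hrow1 : ∑ k, |Δ i k| ≤ √(p : ℝ) * ρ :=
    (sum_abs_le_sqrt_mul _).trans (by gcongr)
  have hcol1 : ∑ k, |Δ k j| ≤ √(p : ℝ) * ρ :=
    (sum_abs_le_sqrt_mul fun k => Δ k j).trans (by gcongr)
  have hΘcol : ∀ j, ∑ k, |Θ₀ k j| ≤ √((maxDegree Θ₀ : ℝ) + 1) * L := fun j => by
    refine (sum_abs_col_le Θ₀ j).trans ?_
    gcongr
    rw [Real.sqrt_le_left hL]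
    have := hΘ₀ (Pi.single j 1)
    rw [Matrix.mulVec_single_one] at this
    simpa using! this
  have hΘrow : ∑ k, |Θ₀ i k| ≤ √((maxDegree Θ₀ : ℝ) + 1) * L := by
    refine le_trans (le_of_eq (Finset.sum_congr rfl fun k _ => ?_)) (hΘcol i)
    rw [← Matrix.transpose_apply Θ₀, hsymm]
  have e1 : |(Δ * S₀ * Δ) i j| ≤ L * ρ ^ 2 := by
    rw [mul_mul_apply_eq_dotProduct]
    refine (abs_dotProduct_le _ _).trans ?_
    have : √((S₀ *ᵥ fun k => Δ k j) ⬝ᵥ (S₀ *ᵥ fun k => Δ k j)) ≤ L * ρ := by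
      refine (Real.sqrt_le_sqrt (hS₀ _)).trans ?_
      rw [Real.sqrt_mul (sq_nonneg L), Real.sqrt_sq hL]
      gcongr
    calc _ ≤ ρ * (L * ρ) := mul_le_mul hrow this (Real.sqrt_nonneg _) hρ
      _ = _ := by ring
  have e2 : |(Δ * (S - S₀) * Θ₀) i j| ≤ w * (√((maxDegree Θ₀ : ℝ) + 1) * L) * (√(p : ℝ) * ρ) := by
    rw [mul_mul_apply_eq_dotProduct]
    refine (abs_dotProduct_mulVec_le hW _ _).trans ?_
    rw [mul_right_comm]
    have := hΘcol j
    gcongr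
  have e3 : |(Θ₀ * (S - S₀) * Δ) i j| ≤ w * (√((maxDegree Θ₀ : ℝ) + 1) * L) * (√(p : ℝ) * ρ) := by
    rw [mul_mul_apply_eq_dotProduct]
    refine (abs_dotProduct_mulVec_le hW _ _).trans ?_
    gcongr
  have e4 : |(Δ * (S - S₀) * Δ) i j| ≤ w * p * ρ ^ 2 := by
    rw [mul_mul_apply_eq_dotProduct]
    refine (abs_dotProduct_mulVec_le hW _ _).trans ?_
    calc _ ≤ w * (√(p : ℝ) * ρ) * (√(p : ℝ) * ρ) := by gcongr
      _ = w * (√(p : ℝ) * √(p : ℝ)) * ρ ^ 2 := by ring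
      _ = _ := by rw [Real.mul_self_sqrt (Nat.cast_nonneg p)]
  rw [remainder_eq h1 h2, ← hΔdef]
  simp only [Matrix.sub_apply, Matrix.neg_apply]
  rw [abs_le] at e1 e2 e3 e4 ⊢
  constructor <;> linarith [e1.1, e1.2, e2.1, e2.2, e3.1, e3.2, e4.1, e4.2]

/-! ### Existence of the graphical Lasso -/

theorem abs_apply_le_trace {p : ℕ} {A : Matrix (Fin p) (Fin p) ℝ} (hA : A.PosSemidef)
    (i j : Fin p) : |A i j| ≤ A.trace := by
  have hd : ∀ k, A k k ≤ A.trace := fun k =>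
    Finset.single_le_sum (f := fun k => A k k) (fun _ _ => hA.diag_nonneg) (Finset.mem_univ k)
  have hs : A j i = A i j := by simpa using hA.1.apply i j
  have h1 := hA.dotProduct_mulVec_nonneg (Pi.single i 1 + Pi.single j 1)
  have h2 := hA.dotProduct_mulVec_nonneg (Pi.single i 1 - Pi.single j 1)
  simp [Matrix.mulVec_add, Matrix.mulVec_sub, add_dotProduct, sub_dotProduct, hs] at h1 h2
  rw [abs_le]
  constructor <;> linarith [hd i, hd j]

/-- Apply `log (a x) ≤ a x - 1` to each eigenvalue. The free slope `a` lets `log det` be dominated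
by an arbitrarily small multiple of the trace. -/
theorem log_det_le {p : ℕ} {A : Matrix (Fin p) (Fin p) ℝ} (hA : A.PosDef) {a : ℝ} (ha : 0 < a) :
    Real.log A.det ≤ a * A.trace - p * (1 + Real.log a) := by
  have h1 : A.det = ∏ i, hA.1.eigenvalues i := by simpa using hA.1.det_eq_prod_eigenvalues
  have h2 : A.trace = ∑ i, hA.1.eigenvalues i := by simpa using hA.1.trace_eq_sum_eigenvalues
  have h3 : (p : ℝ) * (1 + Real.log a) = ∑ _i : Fin p, (1 + Real.log a) := by simp [mul_add]
  rw [h1, h2, h3, Real.log_prod fun i _ => (hA.eigenvalues_pos i).ne', Finset.mul_sum,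
    ← Finset.sum_sub_distrib]
  refine Finset.sum_le_sum fun i _ => ?_
  have h4 := Real.log_le_sub_one_of_pos (mul_pos ha (hA.eigenvalues_pos i))
  rw [Real.log_mul ha.ne' (hA.eigenvalues_pos i).ne'] at h4
  linarith

theorem trace_mul_nonneg {p : ℕ} {A B : Matrix (Fin p) (Fin p) ℝ} (hA : A.PosSemidef)
    (hB : B.PosSemidef) : 0 ≤ (A * B).trace := by
  obtain ⟨U, d, hU, hU', hBd, hd⟩ :=
    exists_orthogonal_diagonalization hB.1 (s := Set.Ici 0) (by
      intro x hx
      rw [hB.1.spectrum_real_eq_range_eigenvalues] at hx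
      obtain ⟨i, rfl⟩ := hx
      exact hB.eigenvalues_nonneg i)
  have h : (A * B).trace = (Uᵀ * A * U * diagonal d).trace := by
    rw [hBd, Matrix.trace_mul_cycle', ← Matrix.mul_assoc, ← Matrix.mul_assoc]
  have hpsd := hA.conjTranspose_mul_mul_same U
  rw [h]
  simp only [Matrix.trace, Matrix.diag_apply, Matrix.mul_diagonal]
  exact Finset.sum_nonneg fun i _ => mul_nonneg (by simpa using hpsd.diag_nonneg (i := i)) (hd i)

theorem isClosed_posSemidef {p : ℕ} : IsClosed {A : Matrix (Fin p) (Fin p) ℝ | A.PosSemidef} := by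
  simp only [posSemidef_iff_dotProduct_mulVec, Set.ofPred_and, Set.ofPred_forall, Matrix.IsHermitian]
  refine (isClosed_eq (by fun_prop) (by fun_prop)).inter (isClosed_iInter fun v => ?_)
  exact isClosed_le (by fun_prop) (by fun_prop)

/-- The graphical Lasso exists as soon as the sample covariance matrix is positive definite. -/
theorem exists_isGraphicalLasso {p : ℕ} {S : Matrix (Fin p) (Fin p) ℝ} {c lam : ℝ} (hc : 0 < c)
    (hS : (S - c • (1 : Matrix (Fin p) (Fin p) ℝ)).PosSemidef) (hlam : 0 ≤ lam) :
    ∃ Θ, IsGraphicalLasso S lam Θ := by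
  set f := glassoObjective S lam with hf
  -- With slope `c / 2` for `log det`, half of the coercive term `c * Θ.trace` survives, and `f Θ ≤
  -- f 1` gives `Θ.trace ≤ R`.
  set R := (f 1 - p * (1 + Real.log (c / 2))) / (c / 2) with hR
  have hpen : ∀ Θ : Matrix (Fin p) (Fin p) ℝ,
      0 ≤ lam * ∑ i, ∑ j, if i = j then 0 else |Θ i j| := fun Θ =>
    mul_nonneg hlam (Finset.sum_nonneg fun _ _ => Finset.sum_nonneg fun _ _ => by
      split_ifs <;> positivity)
  have htr : ∀ Θ : Matrix (Fin p) (Fin p) ℝ, Θ.PosSemidef → c * Θ.trace ≤ (S * Θ).trace := by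
    intro Θ hΘ
    have := trace_mul_nonneg hS hΘ
    rw [Matrix.sub_mul, Matrix.trace_sub, Matrix.smul_mul, Matrix.one_mul, Matrix.trace_smul,
      smul_eq_mul] at this
    linarith
  -- `T` contains every competitor that is at least as good as `1`. The trace bound makes it
  -- bounded; the lower bound on the determinant keeps it off the boundary of the cone, so it is
  -- closed and consists of positive definite matrices.
  set T : Set (Matrix (Fin p) (Fin p) ℝ) :=
    {Θ | Θ.PosSemidef} ∩ ({Θ | Θ.trace ≤ R} ∩ {Θ | Real.exp (-f 1) ≤ Θ.det}) with hT
  have hmem : ∀ Θ : Matrix (Fin p) (Fin p) ℝ, Θ.PosDef → f Θ ≤ f 1 → Θ ∈ T := by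
    intro Θ hΘ hle
    have h1 := htr Θ hΘ.posSemidef
    have h2 := log_det_le hΘ (half_pos hc)
    have h3 := hpen Θ
    have h4 : f Θ = (S * Θ).trace - Real.log Θ.det + lam * ∑ i, ∑ j, if i = j then 0 else |Θ i j| :=
      rfl
    refine ⟨hΘ.posSemidef, ?_, ?_⟩
    · show Θ.trace ≤ R
      rw [hR, le_div_iff₀ (half_pos hc)]
      linarith
    · show Real.exp (-f 1) ≤ Θ.det
      rw [← Real.le_log_iff_exp_le hΘ.det_pos]
      have h5 := mul_nonneg hc.le hΘ.posSemidef.trace_nonneg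
      linarith
  have hTpos : ∀ Θ ∈ T, Θ.PosDef := by
    rintro Θ ⟨h1, -, h2⟩
    have h3 : 0 < Θ.det := (Real.exp_pos _).trans_le h2
    exact h1.posDef_iff_isUnit.2 ((Matrix.isUnit_iff_isUnit_det _).2 h3.ne'.isUnit)
  have hTclosed : IsClosed T := by
    refine isClosed_posSemidef.inter (IsClosed.inter ?_ ?_)
    · exact isClosed_le (by fun_prop) (by fun_prop)
    · exact isClosed_le (by fun_prop) (by fun_prop)
  have hTcompact : IsCompact T := by
    have hK : IsCompact (Set.univ.pi fun _ : Fin p => Set.univ.pi fun _ : Fin p => Set.Icc (-R) R) :=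
      isCompact_univ_pi fun _ => isCompact_univ_pi fun _ => isCompact_Icc
    refine hK.of_isClosed_subset hTclosed ?_
    rintro Θ ⟨h1, h2, -⟩ i - j -
    exact abs_le.1 ((abs_apply_le_trace h1 i j).trans h2)
  have hcont : ContinuousOn f T := by
    have h1 : ContinuousOn (fun Θ : Matrix (Fin p) (Fin p) ℝ => Real.log Θ.det) T :=
      ContinuousOn.log (by fun_prop) fun Θ hΘ => ((hTpos Θ hΘ).det_pos).ne'
    have h2 : Continuous fun Θ : Matrix (Fin p) (Fin p) ℝ =>
        lam * ∑ i, ∑ j, if i = j then 0 else |Θ i j| := by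
      refine continuous_const.mul (continuous_finsetSum _ fun i _ => continuous_finsetSum _ fun j _ => ?_)
      split_ifs <;> fun_prop
    exact ((Continuous.continuousOn (by fun_prop)).sub h1).add h2.continuousOn
  obtain ⟨Θ, hΘT, hΘ⟩ := hTcompact.exists_isMinOn ⟨1, hmem 1 Matrix.PosDef.one le_rfl⟩ hcont
  refine ⟨Θ, hTpos Θ hΘT, fun Θ' hΘ' => ?_⟩
  rcases le_total (f Θ') (f 1) with h | h
  · exact hΘ (hmem Θ' hΘ' h)
  · exact (hΘ (hmem 1 Matrix.PosDef.one le_rfl)).trans h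

/-! ### Deterministic bounds under the bounded spectrum condition -/

theorem covMat_isHermitian {p : ℕ} (μ : Measure (Fin p → ℝ)) : (covMat μ).IsHermitian := by
  ext i j
  simp [covMat, covariance_comm]

theorem sampleCov_isHermitian {n p : ℕ} (X : Matrix (Fin n) (Fin p) ℝ) :
    (sampleCov X).IsHermitian := by
  have := Matrix.isHermitian_conjTranspose_mul_self X
  unfold sampleCov
  rw [Matrix.IsHermitian, Matrix.conjTranspose_smul, ← Matrix.conjTranspose_eq_transpose_of_trivial X,
    this.eq, star_trivial]

theorem BoundedSpectrum.exists_diagonalization {p : ℕ} {L : ℝ} {μ : Measure (Fin p → ℝ)}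
    (hL : 0 < L) (h : BoundedSpectrum L μ) :
    ∃ (U : Matrix (Fin p) (Fin p) ℝ) (d : Fin p → ℝ), Uᵀ * U = 1 ∧ U * Uᵀ = 1 ∧
      (∀ i, d i ∈ Set.Icc (1 / L) L) ∧ precMat μ = U * diagonal d * Uᵀ ∧
      covMat μ = U * diagonal (fun i => (d i)⁻¹) * Uᵀ := by
  obtain ⟨U, d, hU, hU', hP, hd⟩ :=
    exists_orthogonal_diagonalization (covMat_isHermitian μ).inv h.2
  refine ⟨U, d, hU, hU', hd, hP, ?_⟩
  have hdet : IsUnit (covMat μ).det := (Matrix.isUnit_iff_isUnit_det _).1 h.1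
  rw [← Matrix.nonsing_inv_nonsing_inv _ hdet, hP]
  refine Matrix.inv_eq_left_inv ?_
  calc U * diagonal (fun i => (d i)⁻¹) * Uᵀ * (U * diagonal d * Uᵀ)
      = U * (diagonal (fun i => (d i)⁻¹) * (Uᵀ * U) * diagonal d) * Uᵀ := by
        simp only [Matrix.mul_assoc]
    _ = U * 1 * Uᵀ := by
        rw [hU, Matrix.mul_one, Matrix.diagonal_mul_diagonal, ← Matrix.diagonal_one]
        congr 3
        ext i
        exact inv_mul_cancel₀ ((one_div_pos.2 hL).trans_le (hd i).1).ne'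
    _ = 1 := by rw [Matrix.mul_one, hU']

theorem precMat_transpose {p : ℕ} (μ : Measure (Fin p → ℝ)) : (precMat μ)ᵀ = precMat μ := by
  have := (covMat_isHermitian μ).inv
  simpa [precMat, Matrix.IsHermitian, Matrix.conjTranspose_eq_transpose_of_trivial] using this

theorem BoundedSpectrum.precMat_mulVec_le {p : ℕ} {L : ℝ} {μ : Measure (Fin p → ℝ)}
    (hL : 0 < L) (h : BoundedSpectrum L μ) (v : Fin p → ℝ) :
    (precMat μ *ᵥ v) ⬝ᵥ (precMat μ *ᵥ v) ≤ L ^ 2 * (v ⬝ᵥ v) := by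
  obtain ⟨U, d, hU, hU', hd, hP, -⟩ := h.exists_diagonalization hL
  rw [hP]
  refine mulVec_dotProduct_self_le hU hU' (fun i => ?_) v
  rw [abs_of_pos ((one_div_pos.2 hL).trans_le (hd i).1)]
  exact (hd i).2

theorem BoundedSpectrum.covMat_mulVec_le {p : ℕ} {L : ℝ} {μ : Measure (Fin p → ℝ)}
    (hL : 0 < L) (h : BoundedSpectrum L μ) (v : Fin p → ℝ) :
    (covMat μ *ᵥ v) ⬝ᵥ (covMat μ *ᵥ v) ≤ L ^ 2 * (v ⬝ᵥ v) := by
  obtain ⟨U, d, hU, hU', hd, -, hP⟩ := h.exists_diagonalization hL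
  rw [hP]
  refine mulVec_dotProduct_self_le hU hU' (fun i => ?_) v
  have h1 := (one_div_pos.2 hL).trans_le (hd i).1
  rw [abs_of_pos (inv_pos.2 h1), inv_le_comm₀ h1 hL, ← one_div]
  exact (hd i).1

theorem BoundedSpectrum.precMat_posDef {p : ℕ} {L : ℝ} {μ : Measure (Fin p → ℝ)}
    (hL : 0 < L) (h : BoundedSpectrum L μ) : (precMat μ).PosDef := by
  obtain ⟨U, d, hU, hU', hd, hP, -⟩ := h.exists_diagonalization hL
  refine Matrix.PosDef.of_dotProduct_mulVec_pos (covMat_isHermitian μ).inv fun x hx => ?_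
  have h1 := le_dotProduct_mulVec hU' (fun i => (hd i).1) x
  rw [← hP] at h1
  rw [star_trivial]
  refine lt_of_lt_of_le (mul_pos (one_div_pos.2 hL) ?_) h1
  exact lt_of_le_of_ne (by simpa [dotProduct] using Finset.sum_nonneg fun i _ => mul_self_nonneg (x i))
    fun h0 => hx (by simpa using h0.symm)

/-- The graphical Lasso exists when the sample covariance is close to the population covariance. -/
theorem BoundedSpectrum.exists_isGraphicalLasso {p : ℕ} {L lam w : ℝ} {μ : Measure (Fin p → ℝ)}
    (hL : 0 < L) (h : BoundedSpectrum L μ) {S : Matrix (Fin p) (Fin p) ℝ} (hS : S.IsHermitian)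
    (hW : ∀ a b, |(S - covMat μ) a b| ≤ w) (hw : 0 ≤ w) (hpw : p * w ≤ 1 / (2 * L))
    (hlam : 0 ≤ lam) : ∃ Θ, IsGraphicalLasso S lam Θ := by
  obtain ⟨U, d, hU, hU', hd, -, hP⟩ := h.exists_diagonalization hL
  refine DebiasedGlasso.exists_isGraphicalLasso (c := 1 / (2 * L)) (by positivity) ?_ hlam
  refine Matrix.PosSemidef.of_dotProduct_mulVec_nonneg ?_ fun x => ?_
  · refine hS.sub ?_
    rw [Matrix.IsHermitian, Matrix.conjTranspose_smul, Matrix.conjTranspose_one, star_trivial]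
  · have h1 := le_dotProduct_mulVec (d := fun i => (d i)⁻¹) (a := 1 / L) hU' (fun i => by
      have := (one_div_pos.2 hL).trans_le (hd i).1
      rw [one_div]
      exact inv_anti₀ this (hd i).2) x
    rw [← hP] at h1
    have h2 := (abs_le.1 (abs_dotProduct_mulVec_le hW x x)).1
    have hxx : 0 ≤ x ⬝ᵥ x := by
      simpa [dotProduct] using Finset.sum_nonneg fun i _ => mul_self_nonneg (x i)
    -- The perturbation `S - covMat μ` costs at most `w * p` in quadratic form, hence at most half
    -- of the smallest eigenvalue bound `1 / L` of `covMat μ`.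
    have h3 : w * (∑ i, |x i|) * (∑ i, |x i|) ≤ 1 / (2 * L) * (x ⬝ᵥ x) := by
      have h4 := sum_abs_le_sqrt_mul x
      have h5 : (∑ i, |x i|) * (∑ i, |x i|) ≤ p * (x ⬝ᵥ x) := by
        refine (mul_self_le_mul_self (Finset.sum_nonneg fun _ _ => abs_nonneg _) h4).trans_eq ?_
        rw [mul_mul_mul_comm, Real.mul_self_sqrt (Nat.cast_nonneg p), Real.mul_self_sqrt hxx]
      nlinarith [mul_le_mul_of_nonneg_left h5 hw, mul_le_mul_of_nonneg_right hpw hxx]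
    have h6 : 1 / L = 1 / (2 * L) + 1 / (2 * L) := by field_simp; norm_num
    have h7 : star x ⬝ᵥ ((S - (1 / (2 * L)) • (1 : Matrix (Fin p) (Fin p) ℝ)) *ᵥ x)
        = x ⬝ᵥ (covMat μ *ᵥ x) + x ⬝ᵥ ((S - covMat μ) *ᵥ x) - 1 / (2 * L) * (x ⬝ᵥ x) := by
      simp only [star_trivial, Matrix.sub_mulVec, dotProduct_sub, Matrix.smul_mulVec, Matrix.one_mulVec,
        dotProduct_smul, smul_eq_mul]
      ring
    rw [h7]
    rw [h6] at h1
    linarith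

/-- Deterministic bound for the remainder of the de-biased graphical Lasso. -/
theorem BoundedSpectrum.abs_remainder_le {p : ℕ} {L lam w M A : ℝ} {μ : Measure (Fin p → ℝ)}
    (hL : 0 < L) (h : BoundedSpectrum L μ) {S Θ : Matrix (Fin p) (Fin p) ℝ}
    (hW : ∀ a b, |(S - covMat μ) a b| ≤ w) (hw : 0 ≤ w) (hlam : 0 ≤ lam)
    (hΘ : IsGraphicalLasso S lam Θ) (hwM : w ≤ M * lam) (hM : 0 ≤ M) (hA : 0 ≤ A)
    (hpw : p * w ≤ 1)
    (hcase : w ≤ lam ∧ 2 ≤ A ∨ (M + 1) * √(p : ℝ) ≤ A)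
    (hsmall : A * lam * √((p + sparsity (precMat μ) : ℕ) : ℝ) * L ≤ 1 / 4) (i j : Fin p) :
    |remainder S (covMat μ) Θ (precMat μ) i j| ≤
      ((L + 1) * 16 * A ^ 2 * L ^ 4 + 8 * M * A * L ^ 3) * (((p + sparsity (precMat μ) : ℕ) : ℝ)
        * √((maxDegree (precMat μ) : ℝ) + 1) * lam ^ 2) := by
  have hdet : IsUnit (covMat μ).det := (Matrix.isUnit_iff_isUnit_det _).1 h.1
  set Θ₀ := precMat μ with hΘ₀
  set q := √((p + sparsity Θ₀ : ℕ) : ℝ) with hq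
  set D := √((maxDegree Θ₀ : ℝ) + 1) with hD
  set F := √(frobSq (Θ - Θ₀)) with hF
  have hq0 : 0 ≤ q := Real.sqrt_nonneg _
  have hF0 : 0 ≤ F := Real.sqrt_nonneg _
  have hqq : q * q = ((p + sparsity Θ₀ : ℕ) : ℝ) := Real.mul_self_sqrt (Nat.cast_nonneg _)
  have hpq : √(p : ℝ) ≤ q := Real.sqrt_le_sqrt (by push_cast; linarith [(Nat.cast_nonneg (sparsity Θ₀) : (0:ℝ) ≤ _)])
  have hD1 : 1 ≤ D := Real.one_le_sqrt.2 (by linarith [(Nat.cast_nonneg (maxDegree Θ₀) : (0:ℝ) ≤ _)])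
  obtain ⟨U, d, hU, hU', hd, hP, hC⟩ := h.exists_diagonalization hL
  have hbreg := bregman_ge hL hU hU' (fun i => (one_div_pos.2 hL).trans_le (hd i).1)
    (fun i => (hd i).2) hP hC hΘ.1
  have hbasic := glasso_basic_inequality (h.precMat_posDef hL) hΘ hW
  have hpen : ∑ x : Fin p × Fin p, (w * |(Θ - Θ₀) x.1 x.2|
      + if x.1 = x.2 then 0 else lam * (|Θ₀ x.1 x.2| - |Θ x.1 x.2|)) ≤ A * lam * q * F := by
    rcases hcase with ⟨h1, h2⟩ | h1
    · refine (penalized_error_le h1 hlam).trans ?_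
      gcongr
    · refine (penalized_error_le_crude hw hlam).trans ?_
      refine mul_le_mul_of_nonneg_right ?_ hF0
      -- One factor `√p` is absorbed into the constant `A`, the other into `q`.
      calc (w + lam) * p ≤ ((M + 1) * lam) * (√(p : ℝ) * √(p : ℝ)) := by
            rw [Real.mul_self_sqrt (Nat.cast_nonneg p)]
            refine mul_le_mul_of_nonneg_right ?_ (Nat.cast_nonneg p)
            linarith
        _ = ((M + 1) * √(p : ℝ)) * lam * √(p : ℝ) := by ring
        _ ≤ A * lam * q := by gcongr
  -- The quadratic inequality is solved with `x = F / L` and `δ = A * lam * q * L`. The resulting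
  -- radius `ρ = 4 * A * L ^ 2 * lam * q` produces the constants `16 * A ^ 2 * L ^ 4` and `8 * M * A
  -- * L ^ 3`.
  have hx : F / L ≤ 4 * (A * lam * q * L) := by
    refine le_of_sq_div_le (by positivity) (by positivity) hsmall ?_
    refine (hbreg.trans (hbasic.trans hpen)).trans_eq ?_
    field_simp
  have hFρ : F ≤ 4 * A * L ^ 2 * lam * q := by
    rw [div_le_iff₀ hL] at hx
    linarith
  have hmain := DebiasedGlasso.abs_remainder_le hL.le hw (by positivity) (precMat_transpose μ)
    (Matrix.mul_nonsing_inv _ hdet) (Matrix.nonsing_inv_mul _ hdet) (h.covMat_mulVec_le hL)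
    (h.precMat_mulVec_le hL) hW hFρ i j
  refine hmain.trans ?_
  rw [← hqq]
  have e1 : w * p * (4 * A * L ^ 2 * lam * q) ^ 2 ≤ 1 * (4 * A * L ^ 2 * lam * q) ^ 2 := by
    gcongr; linarith
  have e2 : w * (D * L) * (√(p : ℝ) * (4 * A * L ^ 2 * lam * q))
      ≤ (M * lam) * (D * L) * (q * (4 * A * L ^ 2 * lam * q)) := by gcongr
  have e3 : (L + 1) * (4 * A * L ^ 2 * lam * q) ^ 2 * 1 ≤ (L + 1) * (4 * A * L ^ 2 * lam * q) ^ 2 * D := by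
    gcongr
  linarith

/-! ### Sub-exponential variables and Bernstein's inequality -/

section SubExponential

variable {E : Type*} [MeasurableSpace E] {μ : Measure E} {Y : E → ℝ} {b : ℝ}

theorem integrable_exp_abs_div (hY : AEMeasurable Y μ)
    (h : ∫⁻ x, ENNReal.ofReal (Real.exp (|Y x| / b)) ∂μ ≤ 2) :
    Integrable (fun x => Real.exp (|Y x| / b)) μ := by
  refine ⟨((Real.measurable_exp.comp_aemeasurable (hY.abs.div_const b))).aestronglyMeasurable, ?_⟩
  rw [hasFiniteIntegral_iff_ofReal (ae_of_all _ fun x => (Real.exp_pos _).le)]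
  exact h.trans_lt (by simp)

theorem integral_exp_abs_div_le (hY : AEMeasurable Y μ)
    (h : ∫⁻ x, ENNReal.ofReal (Real.exp (|Y x| / b)) ∂μ ≤ 2) :
    ∫ x, Real.exp (|Y x| / b) ∂μ ≤ 2 := by
  rw [integral_eq_lintegral_of_nonneg_ae (ae_of_all _ fun x => (Real.exp_pos _).le)
    (integrable_exp_abs_div hY h).aestronglyMeasurable]
  exact ENNReal.toReal_le_of_le_ofReal zero_le_two (by simpa using h)

theorem abs_pow_le_exp (hb : 0 < b) (y : ℝ) (k : ℕ) :
    |y| ^ k ≤ k.factorial * b ^ k * Real.exp (|y| / b) := by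
  have := Real.pow_div_factorial_le_exp (|y| / b) (by positivity) k
  rw [div_pow, div_div, div_le_iff₀ (by positivity)] at this
  linarith

theorem integrable_abs_pow (hb : 0 < b) (hY : AEMeasurable Y μ)
    (h : ∫⁻ x, ENNReal.ofReal (Real.exp (|Y x| / b)) ∂μ ≤ 2) (k : ℕ) :
    Integrable (fun x => |Y x| ^ k) μ := by
  refine ((integrable_exp_abs_div hY h).const_mul (k.factorial * b ^ k)).mono'
    (hY.abs.pow_const k).aestronglyMeasurable (ae_of_all _ fun x => ?_)
  rw [Real.norm_eq_abs, abs_of_nonneg (by positivity)]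
  exact abs_pow_le_exp hb _ k

theorem integral_abs_pow_le (hb : 0 < b) (hY : AEMeasurable Y μ)
    (h : ∫⁻ x, ENNReal.ofReal (Real.exp (|Y x| / b)) ∂μ ≤ 2) (k : ℕ) :
    ∫ x, |Y x| ^ k ∂μ ≤ 2 * (k.factorial * b ^ k) := by
  calc ∫ x, |Y x| ^ k ∂μ ≤ ∫ x, k.factorial * b ^ k * Real.exp (|Y x| / b) ∂μ :=
        integral_mono (integrable_abs_pow hb hY h k) ((integrable_exp_abs_div hY h).const_mul _)
          fun x => abs_pow_le_exp hb _ k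
    _ = k.factorial * b ^ k * ∫ x, Real.exp (|Y x| / b) ∂μ := integral_const_mul _ _
    _ ≤ k.factorial * b ^ k * 2 := by
        have := integral_exp_abs_div_le hY h
        gcongr
    _ = _ := by ring

theorem integrable_of_subexponential (hb : 0 < b) (hY : AEMeasurable Y μ)
    (h : ∫⁻ x, ENNReal.ofReal (Real.exp (|Y x| / b)) ∂μ ≤ 2) : Integrable Y μ := by
  have := integrable_abs_pow hb hY h 1
  simp only [pow_one] at this
  exact (integrable_norm_iff hY.aestronglyMeasurable).1 this

theorem memLp_two_of_subexponential (hb : 0 < b) (hY : AEMeasurable Y μ)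
    (h : ∫⁻ x, ENNReal.ofReal (Real.exp (|Y x| / b)) ∂μ ≤ 2) : MemLp Y 2 μ := by
  rw [memLp_two_iff_integrable_sq hY.aestronglyMeasurable]
  simpa using integrable_abs_pow hb hY h 2

/-- The second-order Taylor error is at most `|θ y|² exp |θ y|`. Half of the factor `exp (|y| / b)`
absorbs `y²`, the other half absorbs `exp |θ y|`. -/
theorem exp_mul_le_quadratic (hb : 0 < b) {θ : ℝ} (hθ : |θ| ≤ 1 / (2 * b)) (y : ℝ) :
    Real.exp (θ * y) ≤ 1 + θ * y + 8 * b ^ 2 * θ ^ 2 * Real.exp (|y| / b) := by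
  have h1 : Real.exp (θ * y) - (1 + θ * y) ≤ |θ * y| ^ 2 * Real.exp |θ * y| := by
    have h2 := Complex.norm_exp_sub_sum_le_norm_mul_exp ((θ * y : ℝ) : ℂ) 2
    simp only [Finset.sum_range_succ, Finset.range_zero, Finset.sum_empty, pow_zero, Nat.factorial,
      Nat.cast_one, div_one, zero_add, pow_one, Nat.mul_one, Nat.cast_one] at h2
    rw [Complex.norm_real, Real.norm_eq_abs] at h2
    refine le_trans ?_ h2
    rw [← Complex.ofReal_exp, ← Complex.ofReal_one, ← Complex.ofReal_add, ← Complex.ofReal_sub,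
      Complex.norm_real]
    exact le_abs_self _
  have h3 : |θ * y| ≤ |y| / (2 * b) := by
    rw [abs_mul, div_eq_mul_one_div, mul_comm]
    gcongr
  have h4 : |y| ^ 2 ≤ 2 * (2 * b) ^ 2 * Real.exp (|y| / (2 * b)) := by
    simpa using abs_pow_le_exp (b := 2 * b) (by positivity) y 2
  have h5 : Real.exp (|y| / (2 * b)) * Real.exp (|y| / (2 * b)) = Real.exp (|y| / b) := by
    rw [← Real.exp_add]; congr 1; field_simp; norm_num
  have h6 : |θ * y| ^ 2 * Real.exp |θ * y| ≤
      θ ^ 2 * (2 * (2 * b) ^ 2 * Real.exp (|y| / (2 * b))) * Real.exp (|y| / (2 * b)) := by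
    rw [abs_mul, mul_pow, sq_abs]
    rw [abs_mul] at h3
    gcongr
  calc Real.exp (θ * y) ≤ 1 + θ * y
        + θ ^ 2 * (2 * (2 * b) ^ 2 * Real.exp (|y| / (2 * b))) * Real.exp (|y| / (2 * b)) := by linarith
    _ = _ := by rw [← h5]; ring

theorem integrable_exp_mul_of_subexponential (hb : 0 < b) (hY : AEMeasurable Y μ)
    (h : ∫⁻ x, ENNReal.ofReal (Real.exp (|Y x| / b)) ∂μ ≤ 2) {θ : ℝ} (hθ : |θ| ≤ 1 / (2 * b)) :
    Integrable (fun x => Real.exp (θ * Y x)) μ := by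
  refine (integrable_exp_abs_div hY h).mono'
    (Real.measurable_exp.comp_aemeasurable (hY.const_mul θ)).aestronglyMeasurable
    (ae_of_all _ fun x => ?_)
  rw [Real.norm_eq_abs, Real.abs_exp, Real.exp_le_exp]
  calc θ * Y x ≤ |θ| * |Y x| := (le_abs_self _).trans (abs_mul _ _).le
    _ ≤ 1 / (2 * b) * |Y x| := by gcongr
    _ ≤ 1 / b * |Y x| := by gcongr; linarith
    _ = _ := by ring

theorem mgf_sub_mean_le [IsProbabilityMeasure μ] (hb : 0 < b) (hY : AEMeasurable Y μ)
    (h : ∫⁻ x, ENNReal.ofReal (Real.exp (|Y x| / b)) ∂μ ≤ 2) {θ : ℝ} (hθ : |θ| ≤ 1 / (2 * b)) :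
    mgf (fun x => Y x - ∫ x, Y x ∂μ) μ θ ≤ Real.exp (16 * b ^ 2 * θ ^ 2) := by
  set m := ∫ x, Y x ∂μ with hm
  have hI := integrable_of_subexponential hb hY h
  have hE := integrable_exp_abs_div hY h
  have hA : Integrable (fun x => 1 + θ * Y x) μ := (integrable_const _).add (hI.const_mul θ)
  have h1 : ∫ x, Real.exp (θ * Y x) ∂μ ≤ 1 + θ * m + 16 * b ^ 2 * θ ^ 2 := by
    calc ∫ x, Real.exp (θ * Y x) ∂μ
        ≤ ∫ x, (1 + θ * Y x + 8 * b ^ 2 * θ ^ 2 * Real.exp (|Y x| / b)) ∂μ :=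
          integral_mono (integrable_exp_mul_of_subexponential hb hY h hθ)
            (hA.add (hE.const_mul _))
            fun x => exp_mul_le_quadratic hb hθ _
      _ = 1 + θ * m + 8 * b ^ 2 * θ ^ 2 * ∫ x, Real.exp (|Y x| / b) ∂μ := by
          rw [integral_add hA (hE.const_mul _),
            integral_add (integrable_const _) (hI.const_mul θ), integral_const_mul, integral_const_mul]
          simp [hm]
      _ ≤ 1 + θ * m + 8 * b ^ 2 * θ ^ 2 * 2 := by
          have := integral_exp_abs_div_le hY h
          gcongr
      _ = _ := by ring
  have h2 : mgf (fun x => Y x - m) μ θ = Real.exp (-(θ * m)) * ∫ x, Real.exp (θ * Y x) ∂μ := by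
    rw [mgf, ← integral_const_mul]
    congr 1; ext x
    rw [← Real.exp_add]; ring_nf
  rw [h2]
  calc Real.exp (-(θ * m)) * ∫ x, Real.exp (θ * Y x) ∂μ
      ≤ Real.exp (-(θ * m)) * Real.exp (θ * m + 16 * b ^ 2 * θ ^ 2) := by
        gcongr
        refine h1.trans ?_
        linarith [Real.add_one_le_exp (θ * m + 16 * b ^ 2 * θ ^ 2)]
    _ = _ := by rw [← Real.exp_add]; congr 1; ring

/-- One-sided Bernstein inequality for independent sub-exponential variables. -/
theorem measureReal_sum_sub_mean_ge_le {n : ℕ} [IsProbabilityMeasure μ] {Z : Fin n → E → ℝ} {m t : ℝ}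
    (hb : 0 < b) (hZ : ∀ k, AEMeasurable (Z k) μ) (hind : iIndepFun Z μ)
    (h : ∀ k, ∫⁻ x, ENNReal.ofReal (Real.exp (|Z k x| / b)) ∂μ ≤ 2)
    (hm : ∀ k, ∫ x, Z k x ∂μ = m) (ht : 0 ≤ t) (htb : t ≤ 16 * b) :
    μ.real {x | n * t ≤ ∑ k, (Z k x - m)} ≤ Real.exp (-(n * t ^ 2 / (64 * b ^ 2))) := by
  -- The minimizer of the Chernoff exponent `-θ t + 16 b² θ²`; the bound `t ≤ 16 b` keeps it in the
  -- admissible range `θ ≤ 1 / (2b)`.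
  set θ := t / (32 * b ^ 2) with hθ
  have hθ0 : 0 ≤ θ := by positivity
  have hθb : |θ| ≤ 1 / (2 * b) := by
    rw [abs_of_nonneg hθ0, hθ, div_le_div_iff₀ (by positivity) (by positivity)]
    nlinarith
  have hind' : iIndepFun (fun k x => Z k x - m) μ := hind.comp (fun _ y => y - m) (by fun_prop)
  have hZ' : ∀ k, AEMeasurable (fun x => Z k x - m) μ := fun k => (hZ k).sub_const m
  have hmgf := hind'.mgf_sum₀ (t := θ) hZ' Finset.univ
  have hk : ∀ k, mgf (fun x => Z k x - m) μ θ ≤ Real.exp (16 * b ^ 2 * θ ^ 2) := fun k => by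
    have := mgf_sub_mean_le hb (hZ k) (h k) hθb
    rwa [hm k] at this
  have hkpos : ∀ k, 0 < mgf (fun x => Z k x - m) μ θ := fun k => by
    refine mgf_pos ?_
    have := (integrable_exp_mul_of_subexponential hb (hZ k) (h k) hθb).const_mul (Real.exp (-(θ * m)))
    refine this.congr (ae_of_all _ fun x => ?_)
    simp only
    rw [← Real.exp_add]; congr 1; ring
  have hpos : 0 < mgf (∑ k, fun x => Z k x - m) μ θ := by
    rw [hmgf]; exact Finset.prod_pos fun k _ => hkpos k
  -- A Bochner integral is zero for non-integrable functions, so positivity of the product of the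
  -- mgfs yields integrability.
  have hint : Integrable (fun x => Real.exp (θ * (∑ k, fun x => Z k x - m) x)) μ :=
    Integrable.of_integral_ne_zero hpos.ne'
  have hch := measure_ge_le_exp_mul_mgf (n * t) hθ0 hint
  have hset : {x | n * t ≤ ∑ k, (Z k x - m)} = {x | n * t ≤ (∑ k, fun x => Z k x - m) x} := by
    ext x; simp
  rw [hset]
  refine hch.trans ?_
  rw [hmgf]
  calc Real.exp (-θ * (n * t)) * ∏ k, mgf (fun x => Z k x - m) μ θ
      ≤ Real.exp (-θ * (n * t)) * ∏ _k : Fin n, Real.exp (16 * b ^ 2 * θ ^ 2) := by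
        gcongr with k
        · exact fun k _ => (hkpos k).le
        · exact hk k
    _ = Real.exp (-θ * (n * t) + n * (16 * b ^ 2 * θ ^ 2)) := by
        rw [Finset.prod_const, ← Real.exp_nat_mul, ← Real.exp_add]; simp
    _ = _ := by
        congr 1; rw [hθ]; field_simp; ring

theorem measureReal_abs_sum_sub_mean_ge_le {n : ℕ} [IsProbabilityMeasure μ] {Z : Fin n → E → ℝ}
    {m t : ℝ} (hb : 0 < b) (hZ : ∀ k, AEMeasurable (Z k) μ) (hind : iIndepFun Z μ)
    (h : ∀ k, ∫⁻ x, ENNReal.ofReal (Real.exp (|Z k x| / b)) ∂μ ≤ 2)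
    (hm : ∀ k, ∫ x, Z k x ∂μ = m) (ht : 0 ≤ t) (htb : t ≤ 16 * b) :
    μ.real {x | n * t ≤ |∑ k, (Z k x - m)|} ≤ 2 * Real.exp (-(n * t ^ 2 / (64 * b ^ 2))) := by
  have h1 := measureReal_sum_sub_mean_ge_le hb hZ hind h hm ht htb
  have h2 := measureReal_sum_sub_mean_ge_le (Z := fun k x => -Z k x) (m := -m) hb
    (fun k => (hZ k).neg) (hind.comp (fun _ y => -y) (by fun_prop)) (by simpa using h)
    (fun k => by rw [integral_neg, hm k]) ht htb
  have hsub : {x | n * t ≤ |∑ k, (Z k x - m)|} ⊆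
      {x | n * t ≤ ∑ k, (Z k x - m)} ∪ {x | n * t ≤ ∑ k, (-Z k x - -m)} := by
    intro x hx
    rcases le_abs.1 (show n * t ≤ |∑ k, (Z k x - m)| from hx) with h | h
    · exact Or.inl h
    · refine Or.inr ?_
      show n * t ≤ ∑ k, (-Z k x - -m)
      rw [← Finset.sum_neg_distrib] at h
      exact h.trans_eq (Finset.sum_congr rfl fun k _ => by ring)
  refine (measureReal_mono hsub).trans ((measureReal_union_le _ _).trans ?_)
  linarith

end SubExponential

/-! ### Sub-Gaussian vectors and the sample covariance matrix -/

theorem SubGaussianVec.lintegral_exp_le {p : ℕ} {K B : ℝ} {μ : Measure (Fin p → ℝ)}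
    [IsProbabilityMeasure μ] (h : SubGaussianVec K μ) {α : Fin p → ℝ}
    (hα : α ⬝ᵥ α ≤ B ^ 2) :
    ∫⁻ x, ENNReal.ofReal (Real.exp ((α ⬝ᵥ x) ^ 2 / (K ^ 2 * B ^ 2))) ∂μ ≤ 2 := by
  have h0 : 0 ≤ α ⬝ᵥ α := by
    simpa [dotProduct] using Finset.sum_nonneg fun i _ => mul_self_nonneg (α i)
  rcases h0.eq_or_lt with h1 | h1
  · have : α = 0 := by simpa using h1.symm
    simp [this]
  · set r := √(α ⬝ᵥ α) with hr
    have hr0 : 0 < r := Real.sqrt_pos.2 h1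
    have hrr : r ^ 2 = α ⬝ᵥ α := Real.sq_sqrt h0
    have h2 := h (r⁻¹ • α) (by
      have h3 : ∑ i, (r⁻¹ • α) i ^ 2 = r⁻¹ ^ 2 * (α ⬝ᵥ α) := by
        simp only [dotProduct, Finset.mul_sum, Pi.smul_apply, smul_eq_mul]
        exact Finset.sum_congr rfl fun i _ => by ring
      rw [h3, ← hrr, inv_pow, inv_mul_cancel₀ (by positivity)])
    refine le_trans (lintegral_mono fun x => ?_) h2
    refine ENNReal.ofReal_le_ofReal (Real.exp_le_exp.2 ?_)
    rw [smul_dotProduct, smul_eq_mul, sq_abs, mul_pow, inv_pow, ← div_div, div_right_comm]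
    rw [← div_eq_inv_mul, hrr]
    gcongr

/-- Products of linear forms of a sub-Gaussian vector are sub-exponential. -/
theorem SubGaussianVec.lintegral_exp_mul_le {p : ℕ} {K B : ℝ} {μ : Measure (Fin p → ℝ)}
    [IsProbabilityMeasure μ] (h : SubGaussianVec K μ) {α β : Fin p → ℝ}
    (hα : α ⬝ᵥ α ≤ B ^ 2) (hβ : β ⬝ᵥ β ≤ B ^ 2) :
    ∫⁻ x, ENNReal.ofReal (Real.exp (|(α ⬝ᵥ x) * (β ⬝ᵥ x)| / (K ^ 2 * B ^ 2))) ∂μ ≤ 2 := by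
  have h1 := h.lintegral_exp_le hα
  have h2 := h.lintegral_exp_le hβ
  have hpt : ∀ x : Fin p → ℝ, ENNReal.ofReal (Real.exp (|(α ⬝ᵥ x) * (β ⬝ᵥ x)| / (K ^ 2 * B ^ 2))) ≤
      2⁻¹ * (ENNReal.ofReal (Real.exp ((α ⬝ᵥ x) ^ 2 / (K ^ 2 * B ^ 2)))
        + ENNReal.ofReal (Real.exp ((β ⬝ᵥ x) ^ 2 / (K ^ 2 * B ^ 2)))) := by
    intro x
    set u := α ⬝ᵥ x
    set v := β ⬝ᵥ x
    -- The arithmetic–geometric mean inequality is used twice: for `|u v|`, then for the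
    -- exponentials. No independence of the two linear forms is needed.
    have h3 : |u * v| / (K ^ 2 * B ^ 2) ≤ (u ^ 2 / (K ^ 2 * B ^ 2)) / 2 + (v ^ 2 / (K ^ 2 * B ^ 2)) / 2 := by
      have : |u * v| ≤ u ^ 2 / 2 + v ^ 2 / 2 := by
        rw [abs_mul]; nlinarith [sq_nonneg (|u| - |v|), sq_abs u, sq_abs v]
      calc |u * v| / (K ^ 2 * B ^ 2) ≤ (u ^ 2 / 2 + v ^ 2 / 2) / (K ^ 2 * B ^ 2) := by gcongr
        _ = _ := by ring
    have h4 : Real.exp (|u * v| / (K ^ 2 * B ^ 2)) ≤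
        2⁻¹ * (Real.exp (u ^ 2 / (K ^ 2 * B ^ 2)) + Real.exp (v ^ 2 / (K ^ 2 * B ^ 2))) := by
      set a := u ^ 2 / (K ^ 2 * B ^ 2)
      set c := v ^ 2 / (K ^ 2 * B ^ 2)
      have e1 : Real.exp (a / 2) ^ 2 = Real.exp a := by rw [← Real.exp_nat_mul]; congr 1; push_cast; ring
      have e2 : Real.exp (c / 2) ^ 2 = Real.exp c := by rw [← Real.exp_nat_mul]; congr 1; push_cast; ring
      have e3 := Real.exp_le_exp.2 h3
      rw [Real.exp_add] at e3
      nlinarith [sq_nonneg (Real.exp (a / 2) - Real.exp (c / 2))]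
    refine (ENNReal.ofReal_le_ofReal h4).trans_eq ?_
    rw [ENNReal.ofReal_mul (by norm_num), ENNReal.ofReal_add (Real.exp_pos _).le (Real.exp_pos _).le,
      ENNReal.ofReal_inv_of_pos two_pos]
    simp
  refine (lintegral_mono hpt).trans ?_
  rw [lintegral_const_mul _ (by fun_prop), lintegral_add_left (by fun_prop)]
  calc 2⁻¹ * (_ + _) ≤ 2⁻¹ * ((2 : ENNReal) + 2) := by gcongr
    _ = 2 := by
      rw [← two_mul, ← mul_assoc, ENNReal.inv_mul_cancel two_ne_zero (by simp), one_mul]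

section SampleCovariance

variable {p n : ℕ} {μ : Measure (Fin p → ℝ)} {Ω : Type*} [MeasurableSpace Ω] {P : Measure Ω}
  {X : Fin n → Ω → (Fin p → ℝ)}

theorem sampleCov_apply (x : Matrix (Fin n) (Fin p) ℝ) (a b : Fin p) :
    sampleCov x a b = (1 / (n : ℝ)) * ∑ k, x k a * x k b := by
  simp [sampleCov, Matrix.mul_apply]

theorem covMat_apply (hmean : ∀ j, ∫ x, x j ∂μ = 0) (a b : Fin p) :
    covMat μ a b = ∫ x, x a * x b ∂μ := by
  simp [covMat, covariance, hmean]

theorem SubGaussianVec.lintegral_exp_apply_mul_le {K : ℝ} [IsProbabilityMeasure μ]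
    (h : SubGaussianVec K μ) (a b : Fin p) :
    ∫⁻ x, ENNReal.ofReal (Real.exp (|x a * x b| / K ^ 2)) ∂μ ≤ 2 := by
  simpa using h.lintegral_exp_mul_le (B := 1) (α := Pi.single a 1) (β := Pi.single b 1)
    (by simp) (by simp)

/-- Exponential tail bound for the largest entry of the error of the sample covariance matrix. -/
theorem measure_sampleCov_sub_covMat_le {K t : ℝ} [IsProbabilityMeasure μ] [IsProbabilityMeasure P]
    (hK : 0 < K) (hn : 0 < n) (hmean : ∀ j, ∫ x, x j ∂μ = 0) (hsub : SubGaussianVec K μ)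
    (hX : ∀ k, HasLaw (X k) μ P) (hind : iIndepFun X P) (ht : 0 ≤ t) (htK : t ≤ 16 * K ^ 2) :
    P {ω | ¬ ∀ a b, |(sampleCov (Matrix.of fun k => X k ω) - covMat μ) a b| ≤ t} ≤
      ENNReal.ofReal (p ^ 2 * (2 * Real.exp (-(n * t ^ 2 / (64 * (K ^ 2) ^ 2))))) := by
  have hn' : (0 : ℝ) < n := Nat.cast_pos.2 hn
  have hentry : ∀ a b : Fin p,
      P {ω | n * t ≤ |∑ k, (X k ω a * X k ω b - covMat μ a b)|} ≤
        ENNReal.ofReal (2 * Real.exp (-(n * t ^ 2 / (64 * (K ^ 2) ^ 2)))) := by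
    intro a b
    have hf : Measurable fun x : Fin p → ℝ => x a * x b := by fun_prop
    have h1 := measureReal_abs_sum_sub_mean_ge_le (μ := P) (b := K ^ 2)
      (Z := fun k ω => X k ω a * X k ω b) (m := covMat μ a b) (t := t) (by positivity)
      (fun k => hf.comp_aemeasurable (hX k).aemeasurable)
      (hind.comp (fun _ x => x a * x b) fun _ => hf)
      (fun k => by
        have := (hX k).lintegral_comp
          (f := fun x : Fin p → ℝ => ENNReal.ofReal (Real.exp (|x a * x b| / K ^ 2))) (by fun_prop)
        exact this.trans_le (hsub.lintegral_exp_apply_mul_le a b))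
      (fun k => by
        rw [covMat_apply hmean]
        exact (hX k).integral_comp (f := fun x : Fin p → ℝ => x a * x b) hf.aestronglyMeasurable)
      ht htK
    rw [← ofReal_measureReal]
    exact ENNReal.ofReal_le_ofReal h1
  have hset : {ω | ¬ ∀ a b, |(sampleCov (Matrix.of fun k => X k ω) - covMat μ) a b| ≤ t} ⊆
      ⋃ x : Fin p × Fin p, {ω | n * t ≤ |∑ k, (X k ω x.1 * X k ω x.2 - covMat μ x.1 x.2)|} := by
    intro ω hω
    simp only [not_forall, not_le, Set.mem_ofPred_eq] at hω
    obtain ⟨a, b, hab⟩ := hω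
    refine Set.mem_iUnion.2 ⟨(a, b), ?_⟩
    have h2 : ∑ k, (X k ω a * X k ω b - covMat μ a b)
        = n * (sampleCov (Matrix.of fun k => X k ω) - covMat μ) a b := by
      rw [Matrix.sub_apply, sampleCov_apply, Finset.sum_sub_distrib, mul_sub, ← mul_assoc,
        mul_one_div_cancel hn'.ne']
      simp
    show n * t ≤ |∑ k, (X k ω a * X k ω b - covMat μ a b)|
    rw [h2, abs_mul, abs_of_pos hn']
    exact mul_le_mul_of_nonneg_left hab.le hn'.le
  refine (measure_mono hset).trans ((measure_iUnion_fintype_le _ _).trans ?_)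
  refine (Finset.sum_le_sum fun x _ => hentry x.1 x.2).trans_eq ?_
  rw [Finset.sum_const, Finset.card_univ, Fintype.card_prod, Fintype.card_fin, nsmul_eq_mul,
    ENNReal.ofReal_mul (p := (p : ℝ) ^ 2) (by positivity), ENNReal.ofReal_pow (by positivity),
    ENNReal.ofReal_natCast]
  push_cast
  ring

end SampleCovariance

/-! ### Central limit theorem and Slutsky's lemma by characteristic functions -/

section CentralLimit

/-- Taylor's bound for `|y| ≤ 1`, where `e ≤ 4`; for `|y| ≥ 1` every term is at most a multiple of
`|y|³`, with total `1 + 1 + 1 + 1/2 ≤ 4`. -/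
theorem norm_exp_mul_I_sub_le (y : ℝ) :
    ‖Complex.exp (y * Complex.I) - (1 + y * Complex.I - y ^ 2 / 2)‖ ≤ 4 * |y| ^ 3 := by
  rcases le_total |y| 1 with h | h
  · have h2 := Complex.norm_exp_sub_sum_le_norm_mul_exp (y * Complex.I) 3
    have h3 : ∑ m ∈ Finset.range 3, (y * Complex.I) ^ m / (m.factorial : ℂ)
        = 1 + y * Complex.I - y ^ 2 / 2 := by
      simp [Finset.sum_range_succ, mul_pow, Nat.factorial]
      ring
    have h4 : ‖(y * Complex.I : ℂ)‖ = |y| := by simp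
    rw [h3, h4] at h2
    refine h2.trans ?_
    rw [mul_comm]
    have h5 : Real.exp |y| ≤ 4 := by
      refine (Real.exp_le_exp.2 h).trans ?_
      linarith [Real.exp_one_lt_d9]
    gcongr
  · have h1 : ‖Complex.exp (y * Complex.I)‖ = 1 := Complex.norm_exp_ofReal_mul_I y
    have h2 : ‖(1 + y * Complex.I - y ^ 2 / 2 : ℂ)‖ ≤ 1 + |y| + |y| ^ 2 / 2 := by
      refine (norm_sub_le _ _).trans (add_le_add ((norm_add_le _ _).trans ?_) ?_)
      · simp
      · simp
    refine (norm_sub_le _ _).trans ?_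
    rw [h1]
    have h3 : |y| ≤ |y| ^ 3 := by nlinarith [abs_nonneg y, mul_le_mul h h zero_le_one (abs_nonneg y)]
    have h4 : |y| ^ 2 ≤ |y| ^ 3 := pow_le_pow_right₀ h (by norm_num)
    have h5 : 1 ≤ |y| ^ 3 := one_le_pow₀ h
    linarith

theorem norm_charFun_sub_le {ν : Measure ℝ} [IsProbabilityMeasure ν]
    (hI1 : Integrable (fun x => x) ν) (hI2 : Integrable (fun x => x ^ 2) ν)
    (hI3 : Integrable (fun x => |x| ^ 3) ν)
    (h1 : ∫ x, x ∂ν = 0) (h2 : ∫ x, x ^ 2 ∂ν = 1) (t : ℝ) :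
    ‖charFun ν t - (1 - t ^ 2 / 2)‖ ≤ 4 * |t| ^ 3 * ∫ x, |x| ^ 3 ∂ν := by
  have hE : Integrable (fun x : ℝ => Complex.exp ((t * x : ℝ) * Complex.I)) ν := by
    refine Integrable.of_bound (by fun_prop) 1 (ae_of_all _ fun x => ?_)
    rw [Complex.norm_exp_ofReal_mul_I]
  have hJ1 : Integrable (fun x : ℝ => (x : ℂ) * (t * Complex.I)) ν := hI1.ofReal.mul_const _
  have hJ2 : Integrable (fun x : ℝ => ((x ^ 2 : ℝ) : ℂ) * (t ^ 2 / 2)) ν := hI2.ofReal.mul_const _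
  have hJ : Integrable (fun x : ℝ => (1 : ℂ) + (x : ℂ) * (t * Complex.I)) ν :=
    (integrable_const _).add hJ1
  have hQ : ∫ x : ℝ, ((1 : ℂ) + (x : ℂ) * (t * Complex.I) - ((x ^ 2 : ℝ) : ℂ) * (t ^ 2 / 2)) ∂ν
      = 1 - (t : ℂ) ^ 2 / 2 := by
    rw [integral_sub hJ hJ2, integral_add (integrable_const _) hJ1, integral_mul_const,
      integral_mul_const, integral_complex_ofReal, integral_complex_ofReal, h1, h2]
    simp
  have hC : charFun ν t = ∫ x : ℝ, Complex.exp ((t * x : ℝ) * Complex.I) ∂ν := by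
    rw [charFun_apply_real]; simp
  have hJ3 : Integrable (fun x : ℝ => (1 : ℂ) + (x : ℂ) * (t * Complex.I)
      - ((x ^ 2 : ℝ) : ℂ) * (t ^ 2 / 2)) ν := hJ.sub hJ2
  rw [hC, ← hQ, ← integral_sub hE hJ3, ← integral_const_mul]
  refine norm_integral_le_of_norm_le (hI3.const_mul _) (ae_of_all _ fun x => ?_)
  have := norm_exp_mul_I_sub_le (t * x)
  rw [abs_mul, mul_pow, ← mul_assoc] at this
  refine le_trans (le_of_eq ?_) this
  congr 2
  push_cast
  ring

/-- Lyapunov's central limit theorem for triangular arrays with identically distributed rows, on the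
level of characteristic functions. -/
theorem tendsto_charFun_inv_sqrt_pow {ν : ℕ → Measure ℝ} {C : ℝ}
    (hν : ∀ᶠ n in atTop, IsProbabilityMeasure (ν n) ∧ Integrable (fun x => x) (ν n) ∧
      Integrable (fun x => x ^ 2) (ν n) ∧ Integrable (fun x => |x| ^ 3) (ν n) ∧
      ∫ x, x ∂(ν n) = 0 ∧ ∫ x, x ^ 2 ∂(ν n) = 1 ∧ ∫ x, |x| ^ 3 ∂(ν n) ≤ C) (t : ℝ) :
    Tendsto (fun n : ℕ => charFun (ν n) ((√n)⁻¹ * t) ^ n) atTop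
      (𝓝 (Complex.exp (-(t : ℂ) ^ 2 / 2))) := by
  apply Complex.tendsto_pow_exp_of_isLittleO_sub_add_div
  -- The third moment bound makes the error `O(n^{-3/2})`, hence `o(1/n)`, which is what the limit
  -- `(1 + z/n + o(1/n))^n → exp z` requires.
  have h1 : (fun n : ℕ => charFun (ν n) ((√n)⁻¹ * t) - (1 + (-(t : ℂ) ^ 2 / 2) / n)) =O[atTop]
      fun n : ℕ => (√(n : ℝ))⁻¹ * (1 / (n : ℝ)) := by
    refine IsBigO.of_bound (4 * |t| ^ 3 * C) ?_
    filter_upwards [hν, eventually_gt_atTop 0] with n hn hn0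
    obtain ⟨hp, hI1, hI2, hI3, h1, h2, h3⟩ := hn
    have hn0' : (0 : ℝ) < n := Nat.cast_pos.2 hn0
    have hsq : (√(n : ℝ)) ^ 2 = n := Real.sq_sqrt hn0'.le
    have hs : 0 < √(n : ℝ) := Real.sqrt_pos.2 hn0'
    have h4 := norm_charFun_sub_le hI1 hI2 hI3 h1 h2 ((√n)⁻¹ * t)
    have h5 : (1 - (((√(n : ℝ))⁻¹ * t : ℝ) : ℂ) ^ 2 / 2) = 1 + (-(t : ℂ) ^ 2 / 2) / n := by
      have h6 : ((√(n : ℝ))⁻¹ * t) ^ 2 = t ^ 2 / n := by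
        rw [mul_pow, inv_pow, hsq]; ring
      rw [← Complex.ofReal_pow, h6]
      push_cast
      ring
    rw [h5] at h4
    refine h4.trans ?_
    rw [abs_mul, abs_of_pos (inv_pos.2 hs), Real.norm_of_nonneg (by positivity)]
    have h7 : ((√(n : ℝ))⁻¹) ^ 3 = (√(n : ℝ))⁻¹ * (1 / n) := by
      rw [pow_succ', inv_pow, hsq]; ring
    calc 4 * ((√(n : ℝ))⁻¹ * |t|) ^ 3 * ∫ x, |x| ^ 3 ∂(ν n)
        ≤ 4 * ((√(n : ℝ))⁻¹ * |t|) ^ 3 * C := by gcongr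
      _ = 4 * |t| ^ 3 * C * ((√(n : ℝ))⁻¹) ^ 3 := by ring
      _ = _ := by rw [h7]
  refine h1.trans_isLittleO ?_
  have h2 : (fun n : ℕ => (√(n : ℝ))⁻¹) =o[atTop] fun _ => (1 : ℝ) := by
    rw [isLittleO_one_iff]
    exact tendsto_inv_atTop_zero.comp (Real.tendsto_sqrt_atTop.comp tendsto_natCast_atTop_atTop)
  have h3 := h2.mul_isBigO (isBigO_refl (fun n : ℕ => 1 / (n : ℝ)) atTop)
  refine h3.trans_isBigO (IsBigO.of_bound 1 (Eventually.of_forall fun n => ?_))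
  simp

/-- Slutsky's lemma for characteristic functions, with varying probability spaces. -/
theorem tendsto_charFun_add_sub {Ω : ℕ → Type*} [∀ n, MeasurableSpace (Ω n)]
    {P : ∀ n, Measure (Ω n)} [∀ n, IsProbabilityMeasure (P n)] {U V : ∀ n, Ω n → ℝ}
    (hU : ∀ n, AEMeasurable (U n) (P n)) (hV : ∀ n, AEMeasurable (V n) (P n))
    (hV0 : ∀ ε : ℝ, 0 < ε → Tendsto (fun n => P n {ω | ε < |V n ω|}) atTop (𝓝 0)) (t : ℝ) :
    Tendsto (fun n => charFun ((P n).map (fun ω => U n ω + V n ω)) t - charFun ((P n).map (U n)) t)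
      atTop (𝓝 0) := by
  have hchar : ∀ n (Y : Ω n → ℝ), AEMeasurable Y (P n) →
      charFun ((P n).map Y) t = ∫ ω, Complex.exp ((t * Y ω : ℝ) * Complex.I) ∂(P n) := by
    intro n Y hY
    rw [charFun_apply_real, integral_map hY (by fun_prop)]
    simp
  have hint : ∀ n (Y : Ω n → ℝ), AEMeasurable Y (P n) →
      Integrable (fun ω => Complex.exp ((t * Y ω : ℝ) * Complex.I)) (P n) := by
    intro n Y hY
    refine Integrable.of_bound ?_ 1 (ae_of_all _ fun x => ?_)
    · exact AEMeasurable.aestronglyMeasurable (by fun_prop)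
    · rw [Complex.norm_exp_ofReal_mul_I]
  have hbound : ∀ ε : ℝ, 0 < ε → ∀ n,
      ‖charFun ((P n).map (fun ω => U n ω + V n ω)) t - charFun ((P n).map (U n)) t‖ ≤
        |t| * ε + 2 * (P n).real {ω | ε < |V n ω|} := by
    intro ε hε n
    have hnull : NullMeasurableSet {ω | ε < |V n ω|} (P n) :=
      nullMeasurableSet_lt aemeasurable_const (hV n).abs
    have hUV : AEMeasurable (fun ω => U n ω + V n ω) (P n) := (hU n).add (hV n)
    rw [hchar n _ hUV, hchar n _ (hU n),
      ← integral_sub (hint n _ hUV) (hint n _ (hU n))]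
    have hg : Integrable (fun ω => |t| * ε + {ω | ε < |V n ω|}.indicator (fun _ => (2 : ℝ)) ω) (P n) :=
      (integrable_const _).add ((integrable_const _).indicator₀ hnull)
    refine (norm_integral_le_of_norm_le hg (ae_of_all _ fun ω => ?_)).trans_eq ?_
    · have hfac : Complex.exp ((t * (U n ω + V n ω) : ℝ) * Complex.I)
          - Complex.exp ((t * U n ω : ℝ) * Complex.I)
          = Complex.exp ((t * U n ω : ℝ) * Complex.I)
            * (Complex.exp (Complex.I * (t * V n ω : ℝ)) - 1) := by
        rw [mul_sub, ← Complex.exp_add, mul_one]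
        congr 2
        push_cast
        ring
      rw [hfac, norm_mul, Complex.norm_exp_ofReal_mul_I, one_mul]
      by_cases hω : ε < |V n ω|
      · rw [Set.indicator_of_mem (show ω ∈ {ω | ε < |V n ω|} from hω)]
        have h1 : ‖Complex.exp (Complex.I * (t * V n ω : ℝ)) - 1‖ ≤ 2 := by
          refine (norm_sub_le _ _).trans ?_
          rw [mul_comm, Complex.norm_exp_ofReal_mul_I, norm_one]
          norm_num
        have h2 : 0 ≤ |t| * ε := by positivity
        linarith
      · rw [Set.indicator_of_notMem (show ω ∉ {ω | ε < |V n ω|} from hω), add_zero]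
        refine (Real.norm_exp_I_mul_ofReal_sub_one_le).trans ?_
        rw [Real.norm_eq_abs, abs_mul]
        exact mul_le_mul_of_nonneg_left (not_lt.1 hω) (abs_nonneg t)
    · rw [integral_add (integrable_const _) ((integrable_const _).indicator₀ hnull),
        integral_indicator₀ hnull]
      simp [mul_comm]
  rw [tendsto_zero_iff_norm_tendsto_zero]
  rw [Metric.tendsto_atTop']
  intro δ hδ
  -- Where `|V| ≤ ε` the integrands differ by at most `|t| ε ≤ δ / 4`; elsewhere they differ by at
  -- most 2, and that event eventually has probability below `δ / 4`.
  set ε := δ / (4 * (|t| + 1)) with hε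
  have hε0 : 0 < ε := by positivity
  have h1 : Tendsto (fun n => (P n).real {ω | ε < |V n ω|}) atTop (𝓝 0) := by
    have := (ENNReal.tendsto_toReal ENNReal.zero_ne_top).comp (hV0 ε hε0)
    simpa [Measure.real, Function.comp_def] using this
  obtain ⟨N, hN⟩ := eventually_atTop.1 (h1.eventually (gt_mem_nhds (show (0:ℝ) < δ / 4 by positivity)))
  refine ⟨N, fun n hn => ?_⟩
  rw [dist_zero_right, norm_norm]
  have h2 := hbound ε hε0 n
  have h3 := hN n hn.le
  have h4 : |t| * ε ≤ δ / 4 := by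
    rw [hε, mul_div_assoc', div_le_div_iff₀ (by positivity) (by norm_num)]
    nlinarith [abs_nonneg t]
  linarith

end CentralLimit

/-! ### High-probability events and rates -/

section Deviation

variable {p : ℕ → ℕ} {μ : ∀ n, Measure (Fin (p n) → ℝ)} {Ω : ℕ → Type*}
  [∀ n, MeasurableSpace (Ω n)] {P : ∀ n, Measure (Ω n)}
  {X : ∀ n, Fin n → Ω n → (Fin (p n) → ℝ)} {lam : ℕ → ℝ} {K L : ℝ}

theorem log_two_le_log_natCast {m : ℕ} (hm : 2 ≤ m) : Real.log 2 ≤ Real.log m :=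
  Real.log_le_log two_pos (by exact_mod_cast hm)

/-- The sample covariance matrix deviates from the population one by more than
`m √(log p / n)` with polynomially small probability. -/
theorem measure_sampleCov_sub_covMat_rate_le [∀ n, IsProbabilityMeasure (μ n)]
    [∀ n, IsProbabilityMeasure (P n)]
    (hK : 0 < K) (hmean : ∀ n j, ∫ x, x j ∂(μ n) = 0) (hsub : ∀ n, SubGaussianVec K (μ n))
    (hX : ∀ n k, HasLaw (X n k) (μ n) (P n)) (hind : ∀ n, iIndepFun (X n) (P n))
    {m : ℝ} (hm : 0 ≤ m) {n : ℕ} (hn : 0 < n)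
    (hmr : m * √(Real.log (p n) / n) ≤ 16 * K ^ 2) :
    P n {ω | ¬ ∀ a b, |(sampleCov (Matrix.of fun k => X n k ω) - covMat (μ n)) a b|
        ≤ m * √(Real.log (p n) / n)} ≤
      ENNReal.ofReal (p n ^ 2 * (2 * Real.exp (-(m ^ 2 / (64 * K ^ 4) * Real.log (p n))))) := by
  have hlog : 0 ≤ Real.log (p n) := Real.log_natCast_nonneg _
  have hn' : (0 : ℝ) < n := Nat.cast_pos.2 hn
  refine (measure_sampleCov_sub_covMat_le hK hn (hmean n) (hsub n) (hX n) (hind n)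
    (by positivity) hmr).trans_eq ?_
  congr 4
  rw [mul_pow, Real.sq_sqrt (by positivity)]
  field_simp

/-- Two regimes, separated by a threshold `N` depending on `ε`. For `p n > N` the noise level `14 K²
√(log p / n) ≤ lam n` fails with probability at most `2 / p n ≤ ε`. For `p n ≤ N` the level is
multiplied by a large `M`, and `A` may depend on `N`, as the dimension-dependent error bound
requires. The two alternatives on `w` and `A` record which regime holds. -/
theorem exists_measure_deviation_le [∀ n, IsProbabilityMeasure (μ n)]
    [∀ n, IsProbabilityMeasure (P n)] (hp : ∀ n, 2 ≤ p n)
    (hK : 0 < K) (hmean : ∀ n j, ∫ x, x j ∂(μ n) = 0) (hsub : ∀ n, SubGaussianVec K (μ n))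
    (hX : ∀ n k, HasLaw (X n k) (μ n) (P n)) (hind : ∀ n, iIndepFun (X n) (P n))
    (hr : Tendsto (fun n : ℕ => √(Real.log (p n) / n)) atTop (𝓝 0))
    (hlam : ∀ᶠ n in atTop, 14 * K ^ 2 * √(Real.log (p n) / n) ≤ lam n)
    {ε : ℝ} (hε : 0 < ε) :
    ∃ M A : ℝ, 0 < M ∧ 0 < A ∧ ∀ᶠ n in atTop, ∃ w : ℝ, 0 ≤ w ∧ w ≤ M * lam n ∧
      (w ≤ lam n ∧ 2 ≤ A ∨ (M + 1) * √(p n : ℝ) ≤ A) ∧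
      P n {ω | ¬ ∀ a b, |(sampleCov (Matrix.of fun k => X n k ω) - covMat (μ n)) a b| ≤ w} ≤
        ENNReal.ofReal ε := by
  obtain ⟨N, hN⟩ := exists_nat_gt (2 / ε)
  have hlog2 : 0 < Real.log 2 := Real.log_pos one_lt_two
  -- This bounds the failure probability for `2 ≤ p n ≤ N`, since then `p n ^ 2 ≤ N ^ 2` and `log (p
  -- n) ≥ log 2`.
  have hlim : Tendsto (fun m : ℝ => (N : ℝ) ^ 2 * (2 * Real.exp (-((m * (14 * K ^ 2)) ^ 2 / (64 * K ^ 4) * Real.log 2))))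
      atTop (𝓝 0) := by
    have h1 : Tendsto (fun m : ℝ => (m * (14 * K ^ 2)) ^ 2 / (64 * K ^ 4) * Real.log 2) atTop atTop := by
      refine Tendsto.atTop_mul_const hlog2 (Tendsto.atTop_div_const (by positivity) ?_)
      exact (tendsto_pow_atTop two_ne_zero).comp (tendsto_id.atTop_mul_const (by positivity))
    have h2 := ((Real.tendsto_exp_neg_atTop_nhds_zero.comp h1).const_mul 2).const_mul ((N : ℝ) ^ 2)
    simpa using h2
  obtain ⟨M, hM1, hM⟩ := ((eventually_ge_atTop (1 : ℝ)).and (hlim.eventually (gt_mem_nhds hε))).exists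
  have hM0 : 0 < M := zero_lt_one.trans_le hM1
  refine ⟨M, max 2 ((M + 1) * √(N : ℝ)), hM0, by positivity, ?_⟩
  have hsmall : ∀ᶠ n : ℕ in atTop, √(Real.log (p n) / n) < 16 / (M * 14) :=
    hr.eventually (gt_mem_nhds (by positivity))
  filter_upwards [hlam, hsmall, eventually_gt_atTop 0] with n hlamn hsmalln hn
  have hlogn := log_two_le_log_natCast (hp n)
  have hr0 : 0 ≤ √(Real.log (p n) / n) := Real.sqrt_nonneg _
  have hp0 : (0 : ℝ) < p n := by have := hp n; positivity
  have hMr : M * (14 * K ^ 2) * √(Real.log (p n) / n) ≤ 16 * K ^ 2 := by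
    calc M * (14 * K ^ 2) * √(Real.log (p n) / n) ≤ M * (14 * K ^ 2) * (16 / (M * 14)) := by gcongr
      _ = 16 * K ^ 2 := by field_simp
  rcases le_or_gt (p n) N with hpN | hpN
  · refine ⟨M * (14 * K ^ 2) * √(Real.log (p n) / n), by positivity, ?_, Or.inr ?_, ?_⟩
    · rw [mul_assoc]; gcongr
    · refine le_trans ?_ (le_max_right _ _)
      gcongr
    · refine (measure_sampleCov_sub_covMat_rate_le hK hmean hsub hX hind (by positivity) hn hMr).trans
        (ENNReal.ofReal_le_ofReal (le_trans ?_ hM.le))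
      gcongr
  · refine ⟨14 * K ^ 2 * √(Real.log (p n) / n), by positivity, ?_, Or.inl ⟨hlamn, le_max_left _ _⟩, ?_⟩
    · refine hlamn.trans (le_mul_of_one_le_left ((by positivity : (0:ℝ) ≤ _).trans hlamn) hM1)
    · refine (measure_sampleCov_sub_covMat_rate_le hK hmean hsub hX hind (by positivity) hn ?_).trans
        (ENNReal.ofReal_le_ofReal ?_)
      · refine le_trans ?_ hMr
        rw [mul_assoc M]
        exact le_mul_of_one_le_left (by positivity) hM1
      -- The constant 14 is chosen so that `14² / 64 ≥ 3`: the power `p⁻³` beats the `p²` entries of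
      -- the union bound.
      · have h1 : Real.exp (-((14 * K ^ 2) ^ 2 / (64 * K ^ 4) * Real.log (p n))) ≤ ((p n : ℝ) ^ 3)⁻¹ := by
          rw [← Real.exp_log (pow_pos hp0 3), ← Real.exp_neg, Real.log_pow, Real.exp_le_exp]
          have : (14 * K ^ 2) ^ 2 / (64 * K ^ 4) = 196 / 64 := by field_simp; norm_num
          rw [this]
          push_cast
          linarith
        have hNp : 2 / ε < p n := hN.trans (by exact_mod_cast hpN)
        calc (p n : ℝ) ^ 2 * (2 * Real.exp (-((14 * K ^ 2) ^ 2 / (64 * K ^ 4) * Real.log (p n))))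
            ≤ (p n : ℝ) ^ 2 * (2 * ((p n : ℝ) ^ 3)⁻¹) := by gcongr
          _ = 2 / (p n : ℝ) := by field_simp
          _ ≤ ε := by
            rw [div_le_iff₀ hp0]
            rw [div_lt_iff₀ hε] at hNp
            linarith

/-- The sparsity condition carries a full `log p`, and `√(log p) ≤ log p / √(log 2)` because `p ≥
2`. This supplies every smallness condition of the deterministic bounds. -/
theorem tendsto_dimension_mul_rate (hp : ∀ n, 2 ≤ p n) {s d : ℕ → ℕ}
    (hs : (fun n => ((p n + s n : ℕ) : ℝ) * √((d n : ℝ) + 1))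
      =o[atTop] fun n => √(n : ℝ) / Real.log (p n)) :
    Tendsto (fun n : ℕ => ((p n + s n : ℕ) : ℝ) * √(Real.log (p n) / n)) atTop (𝓝 0) := by
  have hlog2 : 0 < Real.log 2 := Real.log_pos one_lt_two
  have h1 := hs.tendsto_div_nhds_zero.const_mul (√(Real.log 2))⁻¹
  rw [mul_zero] at h1
  refine squeeze_zero' (Eventually.of_forall fun n => by positivity) ?_ h1
  filter_upwards [eventually_gt_atTop 0] with n hn
  have hn' : (0 : ℝ) < n := Nat.cast_pos.2 hn
  have hlogn := log_two_le_log_natCast (hp n)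
  have hlog0 : 0 < Real.log (p n) := hlog2.trans_le hlogn
  have hd : 1 ≤ √((d n : ℝ) + 1) := Real.one_le_sqrt.2 (by linarith [(Nat.cast_nonneg (d n) : (0:ℝ) ≤ _)])
  have h2 : √(Real.log (p n)) ≤ (√(Real.log 2))⁻¹ * Real.log (p n) := by
    rw [← div_eq_inv_mul, le_div_iff₀ (Real.sqrt_pos.2 hlog2)]
    calc √(Real.log (p n)) * √(Real.log 2) ≤ √(Real.log (p n)) * √(Real.log (p n)) := by gcongr
      _ = _ := Real.mul_self_sqrt hlog0.le
  rw [Real.sqrt_div hlog0.le]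
  calc ((p n + s n : ℕ) : ℝ) * (√(Real.log (p n)) / √(n : ℝ))
      ≤ (((p n + s n : ℕ) : ℝ) * √((d n : ℝ) + 1)) * (((√(Real.log 2))⁻¹ * Real.log (p n)) / √(n : ℝ)) := by
        gcongr
        exact le_mul_of_one_le_right (Nat.cast_nonneg _) hd
    _ = _ := by field_simp

theorem tendsto_remainder_rate (hp : ∀ n, 2 ≤ p n) {s d : ℕ → ℕ}
    (hlamO : lam =O[atTop] fun n => √(Real.log (p n) / n))
    (hs : (fun n => ((p n + s n : ℕ) : ℝ) * √((d n : ℝ) + 1))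
      =o[atTop] fun n => √(n : ℝ) / Real.log (p n)) :
    Tendsto (fun n : ℕ => ((p n + s n : ℕ) : ℝ) * √((d n : ℝ) + 1) * lam n ^ 2 * √(n : ℝ))
      atTop (𝓝 0) := by
  obtain ⟨C, hC0, hC⟩ := hlamO.exists_pos
  have hlog2 : 0 < Real.log 2 := Real.log_pos one_lt_two
  have h1 := hs.tendsto_div_nhds_zero.const_mul (C ^ 2)
  rw [mul_zero] at h1
  refine squeeze_zero' (Eventually.of_forall fun n => by positivity) ?_ h1
  filter_upwards [eventually_gt_atTop 0, hC.bound] with n hn hb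
  have hn' : (0 : ℝ) < n := Nat.cast_pos.2 hn
  have hlog0 : 0 < Real.log (p n) := hlog2.trans_le (log_two_le_log_natCast (hp n))
  have h2 : lam n ^ 2 ≤ C ^ 2 * (Real.log (p n) / n) := by
    rw [← Real.sq_sqrt (show 0 ≤ Real.log (p n) / n by positivity), ← mul_pow, ← sq_abs (lam n)]
    rw [Real.norm_eq_abs, Real.norm_of_nonneg (Real.sqrt_nonneg _)] at hb
    gcongr
  calc ((p n + s n : ℕ) : ℝ) * √((d n : ℝ) + 1) * lam n ^ 2 * √(n : ℝ)
      ≤ ((p n + s n : ℕ) : ℝ) * √((d n : ℝ) + 1) * (C ^ 2 * (Real.log (p n) / n)) * √(n : ℝ) := by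
        gcongr
    _ = C ^ 2 * (((p n + s n : ℕ) : ℝ) * √((d n : ℝ) + 1) * (Real.log (p n)) * (√(n : ℝ) / n)) := by ring
    _ = _ := by rw [Real.sqrt_div_self]; field_simp

/-- With high probability the graphical Lasso exists, and its de-biased version has a small
remainder. -/
theorem exists_measure_glasso_le [∀ n, IsProbabilityMeasure (μ n)]
    [∀ n, IsProbabilityMeasure (P n)] (hL : 0 < L) (hK : 0 < K) (hp : ∀ n, 2 ≤ p n)
    (hmean : ∀ n j, ∫ x, x j ∂(μ n) = 0) (hspec : ∀ n, BoundedSpectrum L (μ n))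
    (hsub : ∀ n, SubGaussianVec K (μ n))
    (hX : ∀ n k, HasLaw (X n k) (μ n) (P n)) (hind : ∀ n, iIndepFun (X n) (P n))
    (hlamO : lam =O[atTop] fun n => √(Real.log (p n) / n))
    (hlam : ∀ᶠ n in atTop, 14 * K ^ 2 * √(Real.log (p n) / n) ≤ lam n)
    (hs : (fun n => ((p n + sparsity (precMat (μ n)) : ℕ) : ℝ)
        * √((maxDegree (precMat (μ n)) : ℝ) + 1))
      =o[atTop] fun n => √(n : ℝ) / Real.log (p n))
    {ε : ℝ} (hε : 0 < ε) :
    ∃ C : ℝ, 0 < C ∧ ∀ᶠ n in atTop,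
      P n {ω | ¬ ((∃ Θ, IsGraphicalLasso (sampleCov (Matrix.of fun k => X n k ω)) (lam n) Θ) ∧
        ∀ Θ, IsGraphicalLasso (sampleCov (Matrix.of fun k => X n k ω)) (lam n) Θ → ∀ i j,
          |remainder (sampleCov (Matrix.of fun k => X n k ω)) (covMat (μ n)) Θ (precMat (μ n)) i j| ≤
            C * (((p n + sparsity (precMat (μ n)) : ℕ) : ℝ)
              * √((maxDegree (precMat (μ n)) : ℝ) + 1) * lam n ^ 2))} ≤ ENNReal.ofReal ε := by
  have hdim := tendsto_dimension_mul_rate hp hs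
  have hr : Tendsto (fun n : ℕ => √(Real.log (p n) / n)) atTop (𝓝 0) := by
    refine squeeze_zero (fun n => Real.sqrt_nonneg _) (fun n => ?_) hdim
    refine le_mul_of_one_le_left (Real.sqrt_nonneg _) ?_
    have := hp n
    exact_mod_cast (by lia : 1 ≤ p n + sparsity (precMat (μ n)))
  have hdimlam : Tendsto (fun n : ℕ => ((p n + sparsity (precMat (μ n)) : ℕ) : ℝ) * lam n)
      atTop (𝓝 0) :=
    ((isBigO_refl (fun n : ℕ => ((p n + sparsity (precMat (μ n)) : ℕ) : ℝ)) atTop).mul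
      hlamO).trans_tendsto hdim
  obtain ⟨M, A, hM, hA, hev⟩ := exists_measure_deviation_le hp hK hmean hsub hX hind hr hlam hε
  refine ⟨(L + 1) * 16 * A ^ 2 * L ^ 4 + 8 * M * A * L ^ 3, by positivity, ?_⟩
  -- The three thresholds ensure `p w ≤ 1`, `p w ≤ 1 / (2L)` (existence of a minimizer) and the
  -- smallness needed to solve the quadratic inequality.
  have e1 : ∀ᶠ n : ℕ in atTop, ((p n + sparsity (precMat (μ n)) : ℕ) : ℝ) * lam n
      < min (1 / M) (min (1 / (2 * L) / M) (1 / 4 / (A * L))) :=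
    hdimlam.eventually (gt_mem_nhds (by positivity))
  filter_upwards [hev, hlam, e1] with n hn hlamn hsmall
  obtain ⟨w, hw0, hwM, hcase, hP⟩ := hn
  have hlam0 : 0 ≤ lam n := le_trans (by positivity) hlamn
  have hps : (p n : ℝ) ≤ ((p n + sparsity (precMat (μ n)) : ℕ) : ℝ) := by
    exact_mod_cast Nat.le_add_right _ _
  have hpw : p n * w ≤ M * (((p n + sparsity (precMat (μ n)) : ℕ) : ℝ) * lam n) := by
    calc p n * w ≤ ((p n + sparsity (precMat (μ n)) : ℕ) : ℝ) * (M * lam n) := by gcongr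
      _ = _ := by ring
  obtain ⟨hs1, hs2, hs3⟩ := by simpa only [lt_min_iff] using hsmall
  have hpw1 : p n * w ≤ 1 := by
    rw [lt_div_iff₀ hM] at hs1; linarith
  have hpw2 : p n * w ≤ 1 / (2 * L) := by
    rw [lt_div_iff₀ hM] at hs2; linarith
  have hq : √((p n + sparsity (precMat (μ n)) : ℕ) : ℝ) ≤ ((p n + sparsity (precMat (μ n)) : ℕ) : ℝ) := by
    refine Real.sqrt_le_iff.2 ⟨Nat.cast_nonneg _, ?_⟩
    refine le_self_pow₀ ?_ two_ne_zero
    have := hp n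
    exact_mod_cast (by lia : 1 ≤ p n + sparsity (precMat (μ n)))
  have hA4 : A * lam n * √((p n + sparsity (precMat (μ n)) : ℕ) : ℝ) * L ≤ 1 / 4 := by
    rw [lt_div_iff₀ (by positivity)] at hs3
    calc A * lam n * √((p n + sparsity (precMat (μ n)) : ℕ) : ℝ) * L
        ≤ A * lam n * ((p n + sparsity (precMat (μ n)) : ℕ) : ℝ) * L := by gcongr
      _ ≤ 1 / 4 := by linarith
  refine (measure_mono fun ω hω => ?_).trans hP
  intro hdev
  refine hω ⟨(hspec n).exists_isGraphicalLasso hL (sampleCov_isHermitian _) hdev hw0 hpw2 hlam0,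
    fun Θ hΘ i j => ?_⟩
  exact (hspec n).abs_remainder_le hL hdev hw0 hlam0 hΘ hwM hM.le hA.le hpw1 hcase hA4 i j

end Deviation

/-! ### Stochastic orders and the entrywise norm -/

section StochasticOrder

variable {Ω : ℕ → Type*} [∀ n, MeasurableSpace (Ω n)] {P : ∀ n, Measure (Ω n)}
  {Y : ∀ n, Ω n → ℝ} {a b : ℕ → ℝ}

theorem tendsto_zero_of_eventually_le_ofReal {u : ℕ → ENNReal}
    (h : ∀ ε : ℝ, 0 < ε → ∀ᶠ n in atTop, u n ≤ ENNReal.ofReal ε) : Tendsto u atTop (𝓝 0) := by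
  rw [ENNReal.tendsto_nhds_zero]
  intro ε hε
  rcases eq_or_ne ε ⊤ with rfl | hε'
  · exact Eventually.of_forall fun _ => le_top
  · have := h ε.toReal (ENNReal.toReal_pos hε.ne' hε')
    rwa [ENNReal.ofReal_toReal hε'] at this

theorem BigOP.littleOP (h : BigOP P Y a) (hab : a =o[atTop] b) (hb : ∀ n, 0 ≤ b n) :
    LittleOP P Y b := by
  intro ε hε
  refine tendsto_zero_of_eventually_le_ofReal fun δ hδ => ?_
  obtain ⟨M, hM, hev⟩ := h δ hδ
  filter_upwards [hev, hab.bound (show 0 < ε / M by positivity)] with n hn hn2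
  refine (measure_mono fun ω hω => ?_).trans hn
  refine lt_of_le_of_lt ?_ (show ε * b n < |Y n ω| from hω)
  rw [Real.norm_eq_abs, Real.norm_of_nonneg (hb n), div_mul_eq_mul_div, le_div_iff₀ hM] at hn2
  nlinarith [le_abs_self (a n)]

theorem supNorm_le {p : ℕ} {A : Matrix (Fin p) (Fin p) ℝ} {c : ℝ} (hc : 0 ≤ c)
    (h : ∀ i j, |A i j| ≤ c) : supNorm A ≤ c :=
  Real.iSup_le (fun i => Real.iSup_le (fun j => h i j) hc) hc

theorem abs_apply_le_supNorm {p : ℕ} (A : Matrix (Fin p) (Fin p) ℝ) (i j : Fin p) :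
    |A i j| ≤ supNorm A :=
  (le_ciSup (f := fun j => |A i j|) (Set.finite_range _).bddAbove j).trans
    (le_ciSup (f := fun i => ⨆ j, |A i j|) (Set.finite_range _).bddAbove i)

theorem supNorm_nonneg {p : ℕ} (A : Matrix (Fin p) (Fin p) ℝ) : 0 ≤ supNorm A :=
  Real.iSup_nonneg fun _ => Real.iSup_nonneg fun _ => abs_nonneg _

end StochasticOrder

/-! ### Bilinear forms of the sample covariance and their variance -/

section BilinearForms

variable {p n : ℕ} {μ : Measure (Fin p → ℝ)} {Ω : Type*} [MeasurableSpace Ω] {P : Measure Ω}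
  {X : Fin n → Ω → (Fin p → ℝ)} {K B : ℝ}

theorem dotProduct_sampleCov_mulVec (x : Matrix (Fin n) (Fin p) ℝ) (u v : Fin p → ℝ) :
    u ⬝ᵥ (sampleCov x *ᵥ v) = (1 / (n : ℝ)) * ∑ k, (u ⬝ᵥ x k) * (v ⬝ᵥ x k) := by
  rw [sampleCov, Matrix.smul_mulVec, dotProduct_smul, smul_eq_mul, ← Matrix.mulVec_mulVec,
    Matrix.dotProduct_mulVec, Matrix.vecMul_transpose]
  congr 1
  simp only [dotProduct, Matrix.mulVec]
  refine Finset.sum_congr rfl fun k _ => ?_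
  congr 1 <;> exact Finset.sum_congr rfl fun _ _ => mul_comm _ _

theorem dotProduct_covMat_mulVec [IsProbabilityMeasure μ] (hK : 0 < K)
    (hmean : ∀ j, ∫ x, x j ∂μ = 0) (hsub : SubGaussianVec K μ) (u v : Fin p → ℝ) :
    u ⬝ᵥ (covMat μ *ᵥ v) = ∫ x, (u ⬝ᵥ x) * (v ⬝ᵥ x) ∂μ := by
  have hint : ∀ a b, Integrable (fun x : Fin p → ℝ => x a * x b) μ := fun a b =>
    integrable_of_subexponential (b := K ^ 2) (by positivity)
      (by fun_prop) (hsub.lintegral_exp_apply_mul_le a b)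
  have h1 : ∀ x : Fin p → ℝ, (u ⬝ᵥ x) * (v ⬝ᵥ x) = ∑ a, ∑ b, u a * v b * (x a * x b) := fun x => by
    simp only [dotProduct, Finset.sum_mul_sum]
    exact Finset.sum_congr rfl fun a _ => Finset.sum_congr rfl fun b _ => by ring
  simp only [h1]
  rw [integral_finsetSum _ fun a _ => integrable_finsetSum _ fun b _ => (hint a b).const_mul _]
  simp only [dotProduct, Matrix.mulVec, Finset.mul_sum]
  refine Finset.sum_congr rfl fun a _ => ?_
  rw [integral_finsetSum _ fun b _ => (hint a b).const_mul _]
  refine Finset.sum_congr rfl fun b _ => ?_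
  rw [integral_const_mul, covMat_apply hmean]
  ring

theorem measurable_dotProduct_mul (u v : Fin p → ℝ) :
    Measurable fun x : Fin p → ℝ => (u ⬝ᵥ x) * (v ⬝ᵥ x) := by
  simp only [dotProduct]
  fun_prop

/-- The bilinear form is an average of `n` independent copies of one variable, so the factor `n`
cancels and the asymptotic variance is that of a single observation. -/
theorem asympStd_eq [IsProbabilityMeasure μ] [IsProbabilityMeasure P] (hK : 0 < K) (hB : 0 < B)
    (hn : 0 < n) (hsub : SubGaussianVec K μ) (hX : ∀ k, HasLaw (X k) μ P) (hind : iIndepFun X P)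
    {Θ : Matrix (Fin p) (Fin p) ℝ} {i j : Fin p} (hi : Θ.col i ⬝ᵥ Θ.col i ≤ B ^ 2)
    (hj : Θ.col j ⬝ᵥ Θ.col j ≤ B ^ 2) :
    asympStd P (fun ω => Matrix.of fun k => X k ω) Θ i j =
      √(Var[fun x => (Θ.col i ⬝ᵥ x) * (Θ.col j ⬝ᵥ x); μ]) := by
  have hn' : (0 : ℝ) < n := Nat.cast_pos.2 hn
  set f : (Fin p → ℝ) → ℝ := fun x => (Θ.col i ⬝ᵥ x) * (Θ.col j ⬝ᵥ x) with hf
  have hfm : Measurable f := measurable_dotProduct_mul _ _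
  have hf2 : MemLp f 2 μ := memLp_two_of_subexponential (b := K ^ 2 * B ^ 2) (by positivity)
    hfm.aemeasurable (hsub.lintegral_exp_mul_le hi hj)
  have hlaw : ∀ k, IdentDistrib (f ∘ X k) f P μ := fun k =>
    ⟨hfm.comp_aemeasurable (hX k).aemeasurable, hfm.aemeasurable, by
      rw [← AEMeasurable.map_map_of_aemeasurable hfm.aemeasurable (hX k).aemeasurable, (hX k).map_eq]⟩
  have hvar : Var[∑ k, f ∘ X k; P] = ∑ k, Var[f ∘ X k; P] :=
    IndepFun.variance_sum (fun k _ => (hlaw k).memLp_iff.2 hf2) fun a _ b _ hab =>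
      (hind.indepFun hab).comp hfm hfm
  have h1 : (fun ω => Θ.col i ⬝ᵥ (sampleCov (Matrix.of fun k => X k ω) *ᵥ Θ.col j))
      = fun ω => (1 / (n : ℝ)) * (∑ k, f ∘ X k) ω := by
    ext ω
    rw [dotProduct_sampleCov_mulVec, Finset.sum_apply]
    rfl
  rw [asympStd, h1, variance_const_mul, hvar]
  simp only [fun k => (hlaw k).variance_eq]
  congr 1
  simp
  field_simp

theorem abs_sub_pow_three_le (a b : ℝ) : |a - b| ^ 3 ≤ 4 * (|a| ^ 3 + |b| ^ 3) := by
  have h1 : |a - b| ≤ |a| + |b| := abs_sub _ _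
  have ha := abs_nonneg a
  have hb := abs_nonneg b
  calc |a - b| ^ 3 ≤ (|a| + |b|) ^ 3 := by gcongr
    _ ≤ _ := by nlinarith [mul_nonneg (add_nonneg ha hb) (sq_nonneg (|a| - |b|))]

end BilinearForms

/-! ### Asymptotic normality of the linear term -/

section LinearTerm

variable {p : ℕ → ℕ} {μ : ∀ n, Measure (Fin (p n) → ℝ)} {Ω : ℕ → Type*}
  [∀ n, MeasurableSpace (Ω n)] {P : ∀ n, Measure (Ω n)}
  {X : ∀ n, Fin n → Ω n → (Fin (p n) → ℝ)} {b c : ℝ}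

/-- The normalized sums of standardized sub-exponential functions of the observations are
asymptotically standard normal. -/
theorem tendsto_charFun_normalized_sum [∀ n, IsProbabilityMeasure (μ n)]
    [∀ n, IsProbabilityMeasure (P n)]
    (hX : ∀ n k, HasLaw (X n k) (μ n) (P n)) (hind : ∀ n, iIndepFun (X n) (P n)) (hb : 0 < b)
    {f : ∀ n, (Fin (p n) → ℝ) → ℝ} (hf : ∀ n, Measurable (f n))
    (hexp : ∀ n, ∫⁻ x, ENNReal.ofReal (Real.exp (|f n x| / b)) ∂(μ n) ≤ 2) {σ : ℕ → ℝ} (hc : 0 < c)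
    (hσ : ∀ᶠ n in atTop, c ≤ σ n ∧ σ n ^ 2 = Var[f n; μ n]) (t : ℝ) :
    Tendsto (fun n : ℕ => charFun ((P n).map fun ω =>
        (√n)⁻¹ * ∑ k, (∫ x, f n x ∂(μ n) - f n (X n k ω)) / σ n) t) atTop
      (𝓝 (Complex.exp (-(t : ℂ) ^ 2 / 2))) := by
  set m : ℕ → ℝ := fun n => ∫ x, f n x ∂(μ n) with hm
  set g : ∀ n, (Fin (p n) → ℝ) → ℝ := fun n x => (m n - f n x) / σ n with hg
  have hgm : ∀ n, Measurable (g n) := fun n => ((hf n).const_sub _).div_const _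
  have hchar : ∀ n, charFun ((P n).map fun ω => (√n)⁻¹ * ∑ k, g n (X n k ω)) t
      = charFun ((μ n).map (g n)) ((√n)⁻¹ * t) ^ n := by
    intro n
    rw [charFun_map_mul_comp]
    · have h1 := iIndepFun.charFun_map_fun_sum_eq_prod (X := fun k ω => g n (X n k ω)) (P := P n)
        (fun k => (hgm n).comp_aemeasurable (hX n k).aemeasurable)
        ((hind n).comp (fun _ => g n) fun _ => hgm n)
      rw [h1, Finset.prod_apply]
      have h2 : ∀ k, (P n).map (fun ω => g n (X n k ω)) = (μ n).map (g n) := fun k => by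
        rw [← (hX n k).map_eq, AEMeasurable.map_map_of_aemeasurable (hgm n).aemeasurable
          (hX n k).aemeasurable]
        rfl
      simp [h2]
    · exact Finset.aemeasurable_fun_sum _ fun k _ => (hgm n).comp_aemeasurable (hX n k).aemeasurable
  refine Tendsto.congr (fun n => (hchar n).symm) ?_
  -- The constant is `4 / c³` times `E|f|³ + |m|³ ≤ 2 · 3! b³ + (2b)³ = 20 b³`.
  refine tendsto_charFun_inv_sqrt_pow (C := 80 * b ^ 3 / c ^ 3) ?_ t
  filter_upwards [hσ] with n hσn
  obtain ⟨hcσ, hvar⟩ := hσn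
  have hσ0 : 0 < σ n := hc.trans_le hcσ
  have hga : AEMeasurable (g n) (μ n) := (hgm n).aemeasurable
  have hfa := (hf n).aemeasurable (μ := μ n)
  have hf1 := integrable_of_subexponential hb hfa (hexp n)
  have hf2 := memLp_two_of_subexponential hb hfa (hexp n)
  have hf3 := integrable_abs_pow hb hfa (hexp n) 3
  have hi1 : Integrable (fun x => (m n - f n x) / σ n) (μ n) :=
    ((integrable_const _).sub hf1).div_const _
  have hi2 : Integrable (fun x => ((m n - f n x) / σ n) ^ 2) (μ n) := by
    have : MemLp (fun x => (σ n)⁻¹ * (m n - f n x)) 2 (μ n) :=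
      ((memLp_const _).sub hf2).const_mul _
    refine this.integrable_sq.congr (ae_of_all _ fun x => ?_)
    simp only; ring
  have hbound : ∀ x, |(m n - f n x) / σ n| ^ 3 ≤ 4 / c ^ 3 * (|f n x| ^ 3 + |m n| ^ 3) := fun x => by
    rw [abs_div, div_pow, abs_of_pos hσ0, div_mul_eq_mul_div]
    have := abs_sub_pow_three_le (m n) (f n x)
    gcongr
    linarith
  have hi3' : Integrable (fun x => 4 / c ^ 3 * (|f n x| ^ 3 + |m n| ^ 3)) (μ n) :=
    (hf3.add (integrable_const _)).const_mul _
  have hi3 : Integrable (fun x => |(m n - f n x) / σ n| ^ 3) (μ n) := by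
    refine hi3'.mono' (hga.abs.pow_const 3).aestronglyMeasurable (ae_of_all _ fun x => ?_)
    rw [Real.norm_of_nonneg (by positivity)]
    exact hbound x
  refine ⟨Measure.isProbabilityMeasure_map hga, ?_, ?_, ?_, ?_, ?_, ?_⟩
  · rw [integrable_map_measure (by fun_prop) hga]; exact hi1
  · rw [integrable_map_measure (by fun_prop) hga]; exact hi2
  · rw [integrable_map_measure (by fun_prop) hga]; exact hi3
  · rw [integral_map hga (by fun_prop)]
    show ∫ x, (m n - f n x) / σ n ∂(μ n) = 0
    rw [integral_div, integral_sub (integrable_const _) hf1]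
    simp [hm]
  · rw [integral_map hga (by fun_prop)]
    have h1 : ∀ x, ((m n - f n x) / σ n) ^ 2 = (f n x - m n) ^ 2 / σ n ^ 2 := fun x => by
      rw [div_pow, ← neg_sub, neg_sq]
    show ∫ x, ((m n - f n x) / σ n) ^ 2 ∂(μ n) = 1
    simp only [h1]
    have hv : Var[f n; μ n] = ∫ x, (f n x - m n) ^ 2 ∂(μ n) := variance_eq_integral hfa
    rw [integral_div, ← hv, ← hvar, div_self (by positivity)]
  · rw [integral_map hga (by fun_prop)]
    have h3 := integral_abs_pow_le hb hfa (hexp n) 3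
    have h1 := integral_abs_pow_le hb hfa (hexp n) 1
    have hm1 : |m n| ≤ 2 * b := by
      refine (abs_integral_le_integral_abs).trans ?_
      simpa using h1
    have hm3 : |m n| ^ 3 ≤ (2 * b) ^ 3 := by gcongr
    have h6 : ((Nat.factorial 3 : ℕ) : ℝ) = 6 := by norm_num [Nat.factorial]
    rw [h6] at h3
    calc ∫ x, |(m n - f n x) / σ n| ^ 3 ∂(μ n)
        ≤ ∫ x, 4 / c ^ 3 * (|f n x| ^ 3 + |m n| ^ 3) ∂(μ n) := integral_mono hi3 hi3' hbound
      _ = 4 / c ^ 3 * (∫ x, |f n x| ^ 3 ∂(μ n) + |m n| ^ 3) := by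
          rw [integral_const_mul, integral_add hf3 (integrable_const _)]
          simp
      _ ≤ 4 / c ^ 3 * (2 * (6 * b ^ 3) + (2 * b) ^ 3) := by gcongr
      _ = _ := by ring

end LinearTerm

theorem aemeasurable_debiased_apply {p n : ℕ} {Ω : Type*} [MeasurableSpace Ω] {P : Measure Ω}
    {X : Fin n → Ω → (Fin p → ℝ)} (hX : ∀ k, AEMeasurable (X k) P)
    {Θ : Ω → Matrix (Fin p) (Fin p) ℝ} (hΘ : ∀ i j, AEMeasurable (fun ω => Θ ω i j) P)
    (i j : Fin p) :
    AEMeasurable (fun ω => debiased (sampleCov (Matrix.of fun k => X k ω)) (Θ ω) i j) P := by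
  have hXa : ∀ k a, AEMeasurable (fun ω => X k ω a) P := fun k a =>
    (measurable_pi_apply a).comp_aemeasurable (hX k)
  simp only [debiased, Matrix.sub_apply, Matrix.smul_apply, Matrix.mul_apply, sampleCov_apply,
    Matrix.of_apply]
  fun_prop

theorem col_dotProduct_col_le {p : ℕ} {L : ℝ} {Θ : Matrix (Fin p) (Fin p) ℝ}
    (h : ∀ v : Fin p → ℝ, (Θ *ᵥ v) ⬝ᵥ (Θ *ᵥ v) ≤ L ^ 2 * (v ⬝ᵥ v)) (i : Fin p) :
    Θ.col i ⬝ᵥ Θ.col i ≤ L ^ 2 := by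
  have := h (Pi.single i 1)
  rw [Matrix.mulVec_single_one] at this
  simpa using this

theorem debiased_sub_eq {p : ℕ} (S S₀ Θ Θ₀ : Matrix (Fin p) (Fin p) ℝ) :
    debiased S Θ - Θ₀ = -(Θ₀ * (S - S₀) * Θ₀) + remainder S S₀ Θ Θ₀ := by
  rw [remainder]; abel

end DebiasedGlasso

/-! ### The main theorem -/

theorem mainTheorem2 (L K : ℝ) (hL : 1 ≤ L) (hK : 0 < K) :
    ∃ c₀ : ℝ, 0 < c₀ ∧
    ∀ (p : ℕ → ℕ) (_ : ∀ n, 2 ≤ p n)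
      -- the population law of the `n`-th model: centred, bounded spectrum, sub-Gaussian
      (μ : ∀ n, Measure (Fin (p n) → ℝ)) (_ : ∀ n, IsProbabilityMeasure (μ n))
      (_ : ∀ n j, ∫ x, x j ∂(μ n) = 0)
      (_ : ∀ n, DebiasedGlasso.BoundedSpectrum L (μ n))
      (_ : ∀ n, DebiasedGlasso.SubGaussianVec K (μ n))
      -- `n` independent observations with law `μ n`
      (Ω : ℕ → Type*) (_ : ∀ n, MeasurableSpace (Ω n))
      (P : ∀ n, Measure (Ω n)) (_ : ∀ n, IsProbabilityMeasure (P n))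
      (X : ∀ n, Fin n → Ω n → (Fin (p n) → ℝ))
      (_ : ∀ n k, HasLaw (X n k) (μ n) (P n))
      (_ : ∀ n, iIndepFun (X n) (P n))
      -- the tuning parameter
      (lam : ℕ → ℝ)
      (_ : lam =O[atTop] fun n => √(Real.log (p n) / n))
      (_ : ∀ᶠ n in atTop, c₀ * √(Real.log (p n) / n) ≤ lam n)
      -- the sparsity condition
      (_ : (fun n => ((p n + DebiasedGlasso.sparsity (DebiasedGlasso.precMat (μ n)) : ℕ) : ℝ)
            * √((DebiasedGlasso.maxDegree (DebiasedGlasso.precMat (μ n)) : ℝ) + 1))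
          =o[atTop] fun n => √(n : ℝ) / Real.log (p n))
      -- the graphical Lasso, wherever the minimum is attained
      (Θhat : ∀ n, Ω n → Matrix (Fin (p n)) (Fin (p n)) ℝ)
      (_ : ∀ n i j, AEMeasurable (fun ω => Θhat n ω i j) (P n))
      (_ : ∀ n, ∀ᵐ ω ∂(P n),
        (∃ Θ, DebiasedGlasso.IsGraphicalLasso
            (DebiasedGlasso.sampleCov (Matrix.of fun k => X n k ω)) (lam n) Θ) →
          DebiasedGlasso.IsGraphicalLasso
            (DebiasedGlasso.sampleCov (Matrix.of fun k => X n k ω)) (lam n) (Θhat n ω)),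
      -- with probability tending to one the minimum is attained
      Tendsto (fun n => P n {ω | ¬ ∃ Θ, DebiasedGlasso.IsGraphicalLasso
          (DebiasedGlasso.sampleCov (Matrix.of fun k => X n k ω)) (lam n) Θ}) atTop (𝓝 0) ∧
      -- asymptotic linearity with a negligible remainder
      (∃ rem : ∀ n, Ω n → Matrix (Fin (p n)) (Fin (p n)) ℝ,
        (∀ n ω,
          DebiasedGlasso.debiased
              (DebiasedGlasso.sampleCov (Matrix.of fun k => X n k ω)) (Θhat n ω)
              - DebiasedGlasso.precMat (μ n)
            = -(DebiasedGlasso.precMat (μ n)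
                * (DebiasedGlasso.sampleCov (Matrix.of fun k => X n k ω)
                    - DebiasedGlasso.covMat (μ n))
                * DebiasedGlasso.precMat (μ n))
              + rem n ω) ∧
        DebiasedGlasso.BigOP P (fun n ω => DebiasedGlasso.supNorm (rem n ω))
          (fun n => 24 * (8 * L ^ 2) ^ 2 * L
            * ((p n + DebiasedGlasso.sparsity (DebiasedGlasso.precMat (μ n)) : ℕ) : ℝ)
            * √((DebiasedGlasso.maxDegree (DebiasedGlasso.precMat (μ n)) : ℝ) + 1)
            * lam n ^ 2) ∧
        DebiasedGlasso.LittleOP P (fun n ω => DebiasedGlasso.supNorm (rem n ω))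
          (fun n => 1 / √(n : ℝ))) ∧
      -- asymptotic normality of every sequence of entries with nondegenerate variance
      (∀ i j : ∀ n, Fin (p n),
        (∃ c : ℝ, 0 < c ∧ ∀ᶠ n in atTop,
          c ≤ DebiasedGlasso.asympStd (P n) (fun ω => Matrix.of fun k => X n k ω)
                (DebiasedGlasso.precMat (μ n)) (i n) (j n)) →
        TendstoInDistribution
          (fun (n : ℕ) ω => √(n : ℝ)
            * (DebiasedGlasso.debiased
                (DebiasedGlasso.sampleCov (Matrix.of fun k => X n k ω)) (Θhat n ω)
                - DebiasedGlasso.precMat (μ n)) (i n) (j n)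
            / DebiasedGlasso.asympStd (P n) (fun ω => Matrix.of fun k => X n k ω)
                (DebiasedGlasso.precMat (μ n)) (i n) (j n))
          atTop (id : ℝ → ℝ) P (gaussianReal 0 1)) := by
  have hL0 : 0 < L := zero_lt_one.trans_le hL
  refine ⟨14 * K ^ 2, by positivity, ?_⟩
  intro p hp μ _ hmean hspec hsub Ω _ P _ X hX hind lam hlamO hlam hs Θhat hΘm hΘ
  have hmain := fun (ε : ℝ) (hε : 0 < ε) =>
    DebiasedGlasso.exists_measure_glasso_le hL0 hK hp hmean hspec hsub hX hind hlamO hlam hs hε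
  set rem : ∀ n, Ω n → Matrix (Fin (p n)) (Fin (p n)) ℝ := fun n ω =>
    DebiasedGlasso.remainder (DebiasedGlasso.sampleCov (Matrix.of fun k => X n k ω))
      (DebiasedGlasso.covMat (μ n)) (Θhat n ω) (DebiasedGlasso.precMat (μ n)) with hrem
  set a : ℕ → ℝ := fun n =>
    ((p n + DebiasedGlasso.sparsity (DebiasedGlasso.precMat (μ n)) : ℕ) : ℝ)
      * √((DebiasedGlasso.maxDegree (DebiasedGlasso.precMat (μ n)) : ℝ) + 1) * lam n ^ 2 with ha
  have ha0 : ∀ n, 0 ≤ a n := fun n => by positivity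
  -- `O_P` is insensitive to positive constant factors, so any `D` is allowed: the explicit constant
  -- of the statement is one choice, and `D = 1` serves the `o_P` bound.
  have hbig : ∀ D : ℝ, 0 < D → DebiasedGlasso.BigOP P (fun n ω => DebiasedGlasso.supNorm (rem n ω))
      (fun n => D * a n) := by
    intro D hD ε hε
    obtain ⟨C, hC, hev⟩ := hmain ε hε
    refine ⟨C / D, by positivity, ?_⟩
    filter_upwards [hev] with n hn
    refine le_trans (measure_mono_ae ?_) hn
    filter_upwards [hΘ n] with ω hω hlt hgood
    refine not_le.2 (show C / D * (D * a n) < |DebiasedGlasso.supNorm (rem n ω)| from hlt) ?_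
    rw [abs_of_nonneg (DebiasedGlasso.supNorm_nonneg _), ← mul_assoc, div_mul_cancel₀ _ hD.ne']
    exact DebiasedGlasso.supNorm_le (mul_nonneg hC.le (ha0 n)) (hgood.2 _ (hω hgood.1))
  have hrate : a =o[atTop] fun n : ℕ => 1 / √(n : ℝ) := by
    refine isLittleO_of_tendsto' ?_ ?_
    · filter_upwards [eventually_gt_atTop 0] with n hn h0
      have : 0 < 1 / √(n : ℝ) := by positivity
      exact absurd h0 this.ne'
    · refine (DebiasedGlasso.tendsto_remainder_rate hp hlamO hs).congr fun n => ?_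
      rw [div_div_eq_mul_div, div_one]
  have hlittle : DebiasedGlasso.LittleOP P (fun n ω => DebiasedGlasso.supNorm (rem n ω))
      (fun n => 1 / √(n : ℝ)) := by
    refine (hbig 1 one_pos).littleOP ?_ fun n => by positivity
    simpa using hrate
  refine ⟨?_, ⟨rem, fun n ω => DebiasedGlasso.debiased_sub_eq _ _ _ _, ?_, hlittle⟩, ?_⟩
  · refine DebiasedGlasso.tendsto_zero_of_eventually_le_ofReal fun ε hε => ?_
    obtain ⟨C, hC, hev⟩ := hmain ε hε
    filter_upwards [hev] with n hn
    refine le_trans (measure_mono ?_) hn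
    intro ω hω hgood
    exact hω hgood.1
  · have := hbig (24 * (8 * L ^ 2) ^ 2 * L) (by positivity)
    simpa only [ha, mul_assoc] using this
  · rintro i j ⟨c, hc, hσ⟩
    set σ : ℕ → ℝ := fun n => DebiasedGlasso.asympStd (P n) (fun ω => Matrix.of fun k => X n k ω)
      (DebiasedGlasso.precMat (μ n)) (i n) (j n) with hσdef
    set f : ∀ n, (Fin (p n) → ℝ) → ℝ := fun n x =>
      ((DebiasedGlasso.precMat (μ n)).col (i n) ⬝ᵥ x)
        * ((DebiasedGlasso.precMat (μ n)).col (j n) ⬝ᵥ x) with hf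
    have hfm : ∀ n, Measurable (f n) := fun n => DebiasedGlasso.measurable_dotProduct_mul _ _
    have hcol := fun n => DebiasedGlasso.col_dotProduct_col_le ((hspec n).precMat_mulVec_le hL0)
    -- `U` is the standardized linear term, with the sign of `-Θ₀ W Θ₀` built into the summands, and
    -- `V` is the standardized remainder.
    set U : ∀ n, Ω n → ℝ := fun n ω =>
      (√(n : ℝ))⁻¹ * ∑ k, (∫ x, f n x ∂(μ n) - f n (X n k ω)) / σ n with hU
    set V : ∀ n, Ω n → ℝ := fun n ω => √(n : ℝ) * rem n ω (i n) (j n) / σ n with hV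
    set Z : ∀ n, Ω n → ℝ := fun n ω => √(n : ℝ) * (DebiasedGlasso.debiased
      (DebiasedGlasso.sampleCov (Matrix.of fun k => X n k ω)) (Θhat n ω)
        - DebiasedGlasso.precMat (μ n)) (i n) (j n) / σ n with hZ
    have hlin : ∀ n ω, 0 < n → (DebiasedGlasso.precMat (μ n)
        * (DebiasedGlasso.sampleCov (Matrix.of fun k => X n k ω) - DebiasedGlasso.covMat (μ n))
        * DebiasedGlasso.precMat (μ n)) (i n) (j n)
        = -((1 / (n : ℝ)) * ∑ k, (∫ x, f n x ∂(μ n) - f n (X n k ω))) := by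
      intro n ω hn
      have hn' : (n : ℝ) ≠ 0 := by positivity
      have hrow : DebiasedGlasso.precMat (μ n) (i n) = (DebiasedGlasso.precMat (μ n)).col (i n) := by
        conv_lhs => rw [← DebiasedGlasso.precMat_transpose]
        rfl
      rw [DebiasedGlasso.mul_mul_apply_eq_dotProduct, hrow]
      show (DebiasedGlasso.precMat (μ n)).col (i n) ⬝ᵥ
        ((DebiasedGlasso.sampleCov (Matrix.of fun k => X n k ω) - DebiasedGlasso.covMat (μ n)).mulVec
          ((DebiasedGlasso.precMat (μ n)).col (j n))) = _
      rw [Matrix.sub_mulVec, dotProduct_sub, DebiasedGlasso.dotProduct_sampleCov_mulVec,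
        DebiasedGlasso.dotProduct_covMat_mulVec hK (hmean n) (hsub n), Finset.sum_sub_distrib]
      simp only [Finset.sum_const, Finset.card_univ, Fintype.card_fin, nsmul_eq_mul, mul_sub]
      rw [← mul_assoc, one_div_mul_cancel hn', one_mul]
      ring_nf
      rfl
    have hZUV : ∀ n ω, Z n ω = U n ω + V n ω := by
      intro n ω
      rcases Nat.eq_zero_or_pos n with hn | hn
      -- For `n = 0` all three terms vanish because `√0 = 0`.
      · subst hn
        simp [hZ, hU, hV]
      · have hn' : (0 : ℝ) < n := Nat.cast_pos.2 hn
        have hsq : √(n : ℝ) * (1 / n) = (√(n : ℝ))⁻¹ := by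
          rw [mul_one_div, Real.sqrt_div_self]
        simp only [hZ, hU, hV, hrem]
        rw [DebiasedGlasso.debiased_sub_eq _ (DebiasedGlasso.covMat (μ n)), Matrix.add_apply,
          Matrix.neg_apply, hlin n ω hn, neg_neg, mul_add, ← mul_assoc, hsq, ← Finset.sum_div]
        ring
    have hZm : ∀ n, AEMeasurable (Z n) (P n) := fun n =>
      (((DebiasedGlasso.aemeasurable_debiased_apply (fun k => (hX n k).aemeasurable) (hΘm n)
        (i n) (j n)).sub_const _).const_mul _).div_const _
    have hUm : ∀ n, AEMeasurable (U n) (P n) := fun n => by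
      refine (Finset.aemeasurable_fun_sum _ fun k _ => ?_).const_mul _
      exact (((hfm n).comp_aemeasurable (hX n k).aemeasurable).const_sub _).div_const _
    have hVm : ∀ n, AEMeasurable (V n) (P n) := fun n => by
      have : V n = fun ω => Z n ω - U n ω := by ext ω; rw [hZUV]; ring
      rw [this]
      exact (hZm n).sub (hUm n)
    have hV0 : ∀ ε : ℝ, 0 < ε → Tendsto (fun n => P n {ω | ε < |V n ω|}) atTop (𝓝 0) := by
      intro ε hε
      refine tendsto_of_tendsto_of_tendsto_of_le_of_le' tendsto_const_nhds
        (hlittle (ε * c) (by positivity)) (Eventually.of_forall fun _ => zero_le) ?_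
      -- The lower bound `c ≤ σ n` turns `ε < |V|` into a remainder larger than `ε c / √n`, an event
      -- of vanishing probability.
      filter_upwards [hσ, eventually_gt_atTop 0] with n hσn hn
      have hsn : 0 < √(n : ℝ) := by positivity
      have hσ0 : 0 < σ n := hc.trans_le hσn
      refine measure_mono fun ω hω => ?_
      have h1 : ε < |V n ω| := hω
      show ε * c * (1 / √(n : ℝ)) < |DebiasedGlasso.supNorm (rem n ω)|
      simp only [hV] at h1
      rw [abs_div, abs_mul, abs_of_pos hsn, abs_of_pos hσ0, lt_div_iff₀ hσ0] at h1
      rw [mul_one_div, div_lt_iff₀ hsn]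
      have h2 := DebiasedGlasso.abs_apply_le_supNorm (rem n ω) (i n) (j n)
      have h3 : ε * c ≤ ε * σ n := mul_le_mul_of_nonneg_left hσn hε.le
      have h4 := mul_le_mul_of_nonneg_left (h2.trans (le_abs_self _)) hsn.le
      linarith
    refine ⟨hZm, by fun_prop, ProbabilityMeasure.tendsto_iff_tendsto_charFun.2 fun t => ?_⟩
    have hUt := DebiasedGlasso.tendsto_charFun_normalized_sum hX hind
      (b := K ^ 2 * L ^ 2) (by positivity) hfm
      (fun n => (hsub n).lintegral_exp_mul_le (hcol n (i n)) (hcol n (j n))) (σ := σ) hc (by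
        filter_upwards [hσ, eventually_gt_atTop 0] with n hσn hn
        refine ⟨hσn, ?_⟩
        have h1 := DebiasedGlasso.asympStd_eq hK hL0 hn (hsub n) (hX n) (hind n)
          (hcol n (i n)) (hcol n (j n))
        simp only [hσdef]
        rw [h1, Real.sq_sqrt (variance_nonneg _ _)]) t
    have hZt := (DebiasedGlasso.tendsto_charFun_add_sub hUm hVm hV0 t).add hUt
    have hZeq : ∀ n, (fun ω => U n ω + V n ω) = Z n := fun n => funext fun ω => (hZUV n ω).symm
    simp only [hZeq, zero_add] at hZt
    have hG : charFun ((gaussianReal 0 1).map (id : ℝ → ℝ)) t = Complex.exp (-(t : ℂ) ^ 2 / 2) := by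
      rw [Measure.map_id, charFun_gaussianReal]
      congr 1
      simp
      ring
    show Tendsto (fun n => charFun ((P n).map (Z n)) t) atTop
      (𝓝 (charFun ((gaussianReal 0 1).map (id : ℝ → ℝ)) t))
    rw [hG]
    refine hZt.congr fun n => ?_
    simp only [hU]
    ring
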